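/- Let $k$ be an infinite perfect field, $B=k[y_1,\dots,y_n]$ a finitely generated commutative $k$-algebra of Krull dimension $d\in\mathbb{Z}_{\ge 0}$, and $s$ a positive integer. For $c=(c_{ij})\in k^{(d+s)n}$ let $A_c\subseteq B$ be the $k$-subalgebra generated by the $d+s$ linear combinations $\sum_{j=1}^n c_{ij}y_j$, $1\le i\le d+s$. Then there is a nonempty Zariski open subset $U$ of $k^{(d+s)n}$ such that for every $c\in U$, with $A=A_c$: 1. $B$ is a finite $A$-module; and 2. $\dim_A B/A<d$ if and only if for every minimal prime $\mathfrak q$ of $B$ with $\dim B/\mathfrak q=d$ the local ring $B_{\mathfrak q}$ has embedding dimension at most $s$. Here $\dim_A B/A$ is the Krull dimension of the support of the $A$-module $B/A$ (equal to $-\infty$ if $B/A=0$), and the embedding dimension of a Noetherian local ring $(R,\mathfrak m)$ is $\dim_{R/\mathfrak m}\mathfrak m/\mathfrak m^2$. -/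

import Mathlib

/-- A subset of affine space `k^σ` (the set of `k`-rational points) is Zariski open if it is the
complement of the common zero locus of an ideal of polynomials over `k`. -/
def IsZariskiOpen {k σ : Type*} [Field k] (U : Set (σ → k)) : Prop :=
  ∃ I : Ideal (MvPolynomial σ k), U = (MvPolynomial.zeroLocus k I)ᶜ

/-- A property holds for a general point of affine space `k^σ` if it holds at every point of some
nonempty Zariski open subset. -/
def ForGeneral {k σ : Type*} [Field k] (P : (σ → k) → Prop) : Prop :=
  ∃ U : Set (σ → k), IsZariskiOpen U ∧ U.Nonempty ∧ ∀ c ∈ U, P c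

/-- The `k`-subalgebra generated by the `m` linear combinations `∑ j, c (i, j) • y j`. -/
def linearCombinationSubalgebra {k B : Type*} [Field k] [CommRing B] [Algebra k B] {m n : ℕ}
    (y : Fin n → B) (c : Fin m × Fin n → k) : Subalgebra k B :=
  Algebra.adjoin k (Set.range fun i : Fin m => ∑ j : Fin n, c (i, j) • y j)

/-- The quotient `B/A` of `A`-modules, for a subalgebra `A` of `B`. -/
abbrev Subalgebra.QuotientModule {k B : Type*} [Field k] [CommRing B] [Algebra k B]
    (A : Subalgebra k B) : Type _ :=
  B ⧸ LinearMap.range (Algebra.linearMap A B)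

/-- The embedding dimension of a (Noetherian) local ring `(R, m, κ)`: the dimension of `m/m²` as a
`κ`-vector space. -/
noncomputable def embeddingDimension (R : Type*) [CommRing R] [IsLocalRing R] : ℕ :=
  Module.finrank (IsLocalRing.ResidueField R) (IsLocalRing.CotangentSpace R)

/-!
Fix `d` general linear combinations `z` of the generators. They form a Noether normalization
`P = k[z] → B` (`forGeneral_isReduction`): in terms of the span `W` of `1` and the generators,
`W ^ (D + 1) = Λ * W ^ D` for the span `Λ` of `1` and `z`, an open condition on the coefficients that is
nonempty because an algebraic relation lets one drop a generator, by projecting from a point at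
infinity where its leading form does not vanish. The primes `q` of `B` with `dim B/q = d` are those
over the generic point of `P`, they are finitely many, and because `k` is perfect the differentials
of `z` generate `Ω[κ(q)⁄k]` for general `z`, that is, `κ(q)` is étale over `P`
(`forGeneral_isReduction_and_span_D_eq_top`). Hence the cotangent space of `B_q` is the fibre of
`Ω[B⁄P]` at `q` (`embeddingDimension_eq_finrank`).

Let `A` be generated over `P` by `s` further linear combinations `t`. The dimension of the support
of `B/A` is less than `d` if and only if for each such `q` some element of the conductor of `A` in
`B` lies outside `q` (`supportDim_quotientModule_lt_iff`). In this case the differentials of the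
`t i` generate `Ω[B⁄P]` at `q`, so `B_q` has embedding dimension at most `s`
(`embeddingDimension_le_of_mem_conductor`). Conversely, if the embedding dimensions are at most `s`,
then for general `t` the differentials of the `t i` generate `Ω[B⁄P]` at each `q`, and one `t i`
separates the finitely many geometric points of `B` over the generic point of `P`. Then `A → B` is
unramified with a single geometric point in each fibre over the generic point, so it is surjective
there (`notMem_support_quotient_of_unramified`).

The choice of `t` depends on `z`, so this produces only one good coefficient matrix `c₀`
(`exists_supportDim_quotientModule_lt`). The conductor condition spreads out from `c₀` to general
matrices (`forGeneral_exists_conductor_notMem`) by Nakayama's lemma over the subalgebra of `B[c]`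
generated by the linear combinations with indeterminate coefficients `c`.
-/

open TensorProduct

/-! ### General points of affine space -/

open MvPolynomial in
/-- Nonempty basic open sets suffice; over an infinite field, `f ≠ 0` makes the nonvanishing locus
of `f` nonempty. -/
theorem forGeneral_iff {k σ : Type*} [Field k] [Infinite k] {P : (σ → k) → Prop} :
    ForGeneral P ↔ ∃ f : MvPolynomial σ k, f ≠ 0 ∧ ∀ c, eval c f ≠ 0 → P c := by
  constructor
  · rintro ⟨_, ⟨I, rfl⟩, ⟨c, hc⟩, h⟩
    simp only [Set.mem_compl_iff, mem_zeroLocus_iff, not_forall] at hc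
    obtain ⟨f, hf, hfc⟩ := hc
    refine ⟨f, fun h0 => hfc (by simp [h0]), fun c' hc' => h c' fun h0 => hc' ?_⟩
    simpa [aeval_eq_eval] using (mem_zeroLocus_iff.mp h0) f hf
  · rintro ⟨f, hf, h⟩
    refine ⟨_, ⟨Ideal.span {f}, rfl⟩, ?_, fun c hc => h c fun h0 => hc ?_⟩
    · obtain ⟨c, hc⟩ : ∃ c, eval c f ≠ 0 := by
        by_contra! h0
        exact hf (MvPolynomial.funext fun x => by simpa using h0 x)
      refine ⟨c, fun h0 => hc ?_⟩
      simpa [aeval_eq_eval] using (mem_zeroLocus_iff.mp h0) f (Ideal.mem_span_singleton_self f)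
    · rw [zeroLocus_span]
      simpa [aeval_eq_eval] using h0

namespace ForGeneral

open MvPolynomial

variable {k σ τ : Type*} [Field k]

theorem mono {P Q : (σ → k) → Prop} (h : ForGeneral P) (hPQ : ∀ c, P c → Q c) :
    ForGeneral Q := by
  obtain ⟨U, hU, hne, hP⟩ := h
  exact ⟨U, hU, hne, fun c hc => hPQ c (hP c hc)⟩

theorem exists_point {P : (σ → k) → Prop} (h : ForGeneral P) : ∃ c, P c := by
  obtain ⟨U, _, ⟨c, hc⟩, hP⟩ := h
  exact ⟨c, hP c hc⟩

variable [Infinite k]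

theorem of_forall {P : (σ → k) → Prop} (h : ∀ c, P c) : ForGeneral P :=
  forGeneral_iff.mpr ⟨1, one_ne_zero, fun c _ => h c⟩

theorem and {P Q : (σ → k) → Prop} (hP : ForGeneral P) (hQ : ForGeneral Q) :
    ForGeneral fun c => P c ∧ Q c := by
  rw [forGeneral_iff] at *
  obtain ⟨f, hf, hP⟩ := hP
  obtain ⟨g, hg, hQ⟩ := hQ
  refine ⟨f * g, mul_ne_zero hf hg, fun c hc => ?_⟩
  rw [map_mul] at hc
  exact ⟨hP c (left_ne_zero_of_mul hc), hQ c (right_ne_zero_of_mul hc)⟩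

theorem forall_mem_finite {ι : Type*} {s : Set ι} (hs : s.Finite) {P : ι → (σ → k) → Prop}
    (h : ∀ i ∈ s, ForGeneral (P i)) : ForGeneral fun c => ∀ i ∈ s, P i c := by
  induction s, hs using Set.Finite.induction_on with
  | empty => exact of_forall (by simp)
  | @insert a s _ _ ih =>
    refine ((h a (by simp)).and (ih fun i hi => h i (by simp [hi]))).mono ?_
    rintro c ⟨h1, h2⟩ i hi
    rcases hi with rfl | hi
    exacts [h1, h2 i hi]

theorem forall_finite {ι : Type*} [Finite ι] {P : ι → (σ → k) → Prop}
    (h : ∀ i, ForGeneral (P i)) : ForGeneral fun c => ∀ i, P i c :=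
  (forall_mem_finite Set.finite_univ fun i _ => h i).mono fun _ hc i => hc i trivial

/-- A general point has general coordinates along an injection of the index sets. -/
theorem comp_injective {P : (σ → k) → Prop} (h : ForGeneral P) {e : σ → τ}
    (he : Function.Injective e) : ForGeneral fun c : τ → k => P fun i => c (e i) := by
  rw [forGeneral_iff] at *
  obtain ⟨f, hf, h⟩ := h
  refine ⟨rename e f, fun h0 => hf (rename_injective e he (by simpa using h0)), fun c hc => ?_⟩
  exact h _ (by rwa [eval_rename] at hc)

end ForGeneral

/-- The non-vanishing locus, on `k`-rational points, of a polynomial with coefficients in a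
`k`-algebra `E` is Zariski open over `k`: a `k`-linear functional on `E` that is nonzero on the
given value turns the polynomial into one over `k`. -/
theorem exists_polynomial_of_aeval_ne_zero {k E σ : Type*} [Field k] [CommRing E] [Algebra k E]
    (g : MvPolynomial σ E) (c₀ : σ → k)
    (h : MvPolynomial.eval (fun i => algebraMap k E (c₀ i)) g ≠ 0) :
    ∃ f : MvPolynomial σ k, MvPolynomial.eval c₀ f ≠ 0 ∧
      ∀ c, MvPolynomial.eval c f ≠ 0 →
        MvPolynomial.eval (fun i => algebraMap k E (c i)) g ≠ 0 := by
  obtain ⟨φ, hφ⟩ : ∃ φ : Module.Dual k E,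
      φ (MvPolynomial.eval (fun i => algebraMap k E (c₀ i)) g) ≠ 0 := by
    by_contra! h0
    exact h ((Module.forall_dual_apply_eq_zero_iff k _).mp h0)
  let f : MvPolynomial σ k := ∑ m ∈ g.support, MvPolynomial.monomial m (φ (g.coeff m))
  have key (c : σ → k) : MvPolynomial.eval c f =
      φ (MvPolynomial.eval (fun i => algebraMap k E (c i)) g) := by
    rw [MvPolynomial.eval_eq (fun i => algebraMap k E (c i)) g, map_sum, map_sum]
    refine Finset.sum_congr rfl fun m _ => ?_
    rw [MvPolynomial.eval_monomial, Finsupp.prod]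
    simp only [← map_pow, ← map_prod]
    rw [mul_comm (MvPolynomial.coeff m g), ← Algebra.smul_def, map_smul, smul_eq_mul, mul_comm]
  refine ⟨f, by rwa [key], fun c hc h0 => hc ?_⟩
  rw [key, h0, map_zero]

theorem ForGeneral.of_eval_ne_zero {k E σ : Type*} [Field k] [Infinite k] [CommRing E]
    [Algebra k E] (g : MvPolynomial σ E) (c₀ : σ → k)
    (h : MvPolynomial.eval (fun i => algebraMap k E (c₀ i)) g ≠ 0) :
    ForGeneral fun c : σ → k => MvPolynomial.eval (fun i => algebraMap k E (c i)) g ≠ 0 := by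
  obtain ⟨f, hf, h⟩ := exists_polynomial_of_aeval_ne_zero g c₀ h
  exact forGeneral_iff.mpr ⟨f, fun h0 => hf (by simp [h0]), h⟩

/-! ### Spanning as an open condition -/

section Spanning

variable {k L V σ ι : Type*} [Field k] [Field L] [Algebra k L] [AddCommGroup V] [Module k V]
  [Module L V] [IsScalarTower k L V] [FiniteDimensional L V] [Fintype σ]

open MvPolynomial in
/-- If the vectors `v i + ∑ τ, c τ • u i τ`, which depend affinely on the parameter `c`, span `V`
at `c₀`, then some of them form a basis there; their coordinate matrix in this basis is a matrix
of polynomials whose determinant does not vanish at `c₀`. -/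
theorem exists_basis_of_span_affine_eq_top (v : ι → V) (u : ι → σ → V) (c₀ : σ → k)
    (h : Submodule.span L (Set.range fun i => v i + ∑ τ, c₀ τ • u i τ) = ⊤) :
    ∃ (r : ℕ) (b : Module.Basis (Fin r) L V) (e : Fin r → ι),
      eval (fun τ => algebraMap k L (c₀ τ)) (Matrix.of fun i j =>
        C (b.repr (v (e i)) j) + ∑ τ, X τ * C (b.repr (u (e i) τ) j) :
          Matrix (Fin r) (Fin r) (MvPolynomial σ L)).det ≠ 0 := by
  classical
  let b₀ := Module.Basis.ofSpan h.ge
  have hfin : Finite ((linearIndepOn_empty L id).extend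
      (Set.empty_subset (Set.range fun i => v i + ∑ τ, c₀ τ • u i τ))) :=
    Module.Finite.finite_basis b₀
  let b := b₀.reindex (Finite.equivFin _)
  have hb (i) : ∃ a, v a + ∑ τ, c₀ τ • u a τ = b i :=
    Module.Basis.ofSpan_subset h.ge ⟨(Finite.equivFin _).symm i, by rw [Module.Basis.reindex_apply]⟩
  choose e he using hb
  refine ⟨_, b, e, ?_⟩
  rw [RingHom.map_det]
  refine ((congrArg Matrix.det (a₂ := 1) ?_).trans Matrix.det_one).trans_ne one_ne_zero
  ext i j
  have := congrArg (fun x => b.repr x j) (he i)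
  simp only [map_add, map_sum, Finsupp.add_apply, Finsupp.finsetSum_apply,
    Module.Basis.repr_self] at this
  simp only [RingHom.mapMatrix_apply, Matrix.map_apply, Matrix.of_apply, map_add, map_sum, map_mul,
    eval_C, eval_X, Matrix.one_apply]
  rw [Finsupp.single_apply] at this
  rw [← this]
  congr 1
  refine Finset.sum_congr rfl fun τ _ => ?_
  rw [← algebraMap_smul L, map_smul, Finsupp.smul_apply, smul_eq_mul]

open MvPolynomial in
/-- Spanning a finite-dimensional space by vectors depending affinely on `c` is an open
condition on `c`. -/
theorem ForGeneral.span_affine_eq_top [Infinite k] (v : ι → V) (u : ι → σ → V) (c₀ : σ → k)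
    (h : Submodule.span L (Set.range fun i => v i + ∑ τ, c₀ τ • u i τ) = ⊤) :
    ForGeneral fun c : σ → k =>
      Submodule.span L (Set.range fun i => v i + ∑ τ, c τ • u i τ) = ⊤ := by
  obtain ⟨r, b, e, hdet⟩ := exists_basis_of_span_affine_eq_top v u c₀ h
  refine (ForGeneral.of_eval_ne_zero _ c₀ hdet).mono fun c hc => ?_
  rw [RingHom.map_det] at hc
  have key : b.toMatrix (fun i => v (e i) + ∑ τ, c τ • u (e i) τ) =
      ((eval (fun τ => algebraMap k L (c τ))).mapMatrix (Matrix.of fun i j =>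
        C (b.repr (v (e i)) j) + ∑ τ, X τ * C (b.repr (u (e i) τ) j) :
          Matrix (Fin r) (Fin r) (MvPolynomial σ L))).transpose := by
    ext i j
    simp only [Module.Basis.toMatrix_apply, map_add, map_sum, Finsupp.add_apply,
      Finsupp.finsetSum_apply, Matrix.transpose_apply, RingHom.mapMatrix_apply, Matrix.map_apply,
      Matrix.of_apply, map_mul, eval_C, eval_X]
    congr 1
    refine Finset.sum_congr rfl fun τ _ => ?_
    rw [← algebraMap_smul L, map_smul, Finsupp.smul_apply, smul_eq_mul]
  have := ((Module.Basis.is_basis_iff_det b).mpr (by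
    rw [Module.Basis.det_apply, key, Matrix.det_transpose]
    exact isUnit_iff_ne_zero.mpr hc : IsUnit (b.det _))).2
  rw [eq_top_iff, ← this]
  refine Submodule.span_mono ?_
  rintro _ ⟨i, rfl⟩
  exact ⟨e i, rfl⟩

/-- At least `dim V` general linear combinations of a finite spanning family of `V`, with
coefficients in a subfield, span `V`. -/
theorem ForGeneral.span_linearCombination_eq_top [Infinite k] {m n : ℕ} (w : Fin n → V)
    (hw : Submodule.span L (Set.range w) = ⊤) (hm : Module.finrank L V ≤ m) :
    ForGeneral fun c : Fin m × Fin n → k =>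
      Submodule.span L (Set.range fun i => ∑ j, c (i, j) • w j) = ⊤ := by
  classical
  let b := Module.Basis.ofSpan hw.ge
  have hfin : Finite ((linearIndepOn_empty L id).extend (Set.empty_subset (Set.range w))) :=
    Module.Finite.finite_basis b
  have hb (i) : ∃ a, w a = b i := Module.Basis.ofSpan_subset hw.ge ⟨i, rfl⟩
  choose e he using hb
  obtain ⟨g⟩ : Nonempty ((linearIndepOn_empty L id).extend (Set.empty_subset (Set.range w)) ↪
      Fin m) := by
    have := Fintype.ofFinite ((linearIndepOn_empty L id).extend (Set.empty_subset (Set.range w)))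
    refine Function.Embedding.nonempty_of_card_le ?_
    rwa [Fintype.card_fin, ← Module.finrank_eq_card_basis b]
  let c₀ : Fin m × Fin n → k := fun p => if ∃ a, g a = p.1 ∧ e a = p.2 then 1 else 0
  have key (c : Fin m × Fin n → k) (i : Fin m) : ∑ j, c (i, j) • w j =
      0 + ∑ τ : Fin m × Fin n, c τ • if τ.1 = i then w τ.2 else 0 := by
    rw [zero_add, Fintype.sum_prod_type, Finset.sum_eq_single i]
    · simp
    · intro a _ ha
      simp [ha]
    · simp
  simp only [key]
  refine ForGeneral.span_affine_eq_top (fun _ => 0)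
    (fun i (τ : Fin m × Fin n) => if τ.1 = i then w τ.2 else 0) c₀ ?_
  simp only [← key]
  rw [eq_top_iff, ← b.span_eq]
  refine Submodule.span_mono ?_
  rintro _ ⟨a, rfl⟩
  refine ⟨g a, ?_⟩
  simp only [c₀]
  rw [Finset.sum_eq_single (e a), if_pos ⟨a, rfl, rfl⟩, one_smul, he]
  · intro j _ hj
    rw [if_neg, zero_smul]
    rintro ⟨a', h1, h2⟩
    exact hj (by rw [← h2, g.injective h1])
  · simp

end Spanning

/-! ### Dimension in integral extensions -/

theorem MvPolynomial.ringKrullDim_fin (k : Type*) [Field k] (d : ℕ) :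
    ringKrullDim (MvPolynomial (Fin d) k) = d := by
  rw [MvPolynomial.ringKrullDim_of_isNoetherianRing, ringKrullDim_eq_zero_of_field, zero_add,
    Nat.card_eq_fintype_card, Fintype.card_fin]

theorem ringKrullDim_le_of_isIntegral_of_injective {R S : Type*} [CommRing R] [CommRing S]
    [Algebra R S] [Algebra.IsIntegral R S] (h : Function.Injective (algebraMap R S)) :
    ringKrullDim R ≤ ringKrullDim S := by
  refine iSup_le fun l => ?_
  obtain ⟨Q, -, hQ, hQl⟩ := Ideal.exists_ideal_over_prime_of_isIntegral l.head.asIdeal (⊥ : Ideal S)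
    (by rw [← RingHom.ker_eq_comap_bot, (RingHom.injective_iff_ker_eq_bot _).mp h]; exact bot_le)
  have : Q.LiesOver (RelSeries.head l).asIdeal := ⟨hQl.symm⟩
  obtain ⟨L, hL, -⟩ := Ideal.exists_ltSeries_of_hasGoingUp l Q
  rw [← hL]
  exact Order.LTSeries.length_le_krullDim L

theorem PrimeSpectrum.comap_strictMono_of_isIntegral {R S : Type*} [CommRing R] [CommRing S]
    [Algebra R S] [Algebra.IsIntegral R S] :
    StrictMono (PrimeSpectrum.comap (algebraMap R S)) := fun _ _ h =>
  Ideal.IsIntegral.comap_lt_comap h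

/-- A chain in `α` can be prolonged downwards by `b` after mapping it to `β`. -/
theorem Order.krullDim_lt_of_strictMono_of_forall_lt {α β : Type*} [Preorder α] [Preorder β]
    {d : ℕ} (hβ : Order.krullDim β = d) (f : α → β) (hf : StrictMono f) (b : β)
    (hb : ∀ a, b < f a) : Order.krullDim α < d := by
  rw [Order.krullDim_lt_coe_iff]
  intro l
  let l' : LTSeries β := (l.map f hf).cons b (hb _)
  have hl' : l'.length = l.length + 1 := by
    change 0 + (l.map f hf).length + 1 = _
    rw [zero_add]; rfl
  have := Order.LTSeries.length_le_krullDim l'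
  rw [hβ, hl'] at this
  have h2 : l.length + 1 ≤ d := by exact_mod_cast this
  omega

/-- There are no inclusions between the primes over a given prime. -/
theorem Ideal.mem_minimalPrimes_of_comap_eq_bot {P B : Type*} [CommRing P] [CommRing B]
    [Algebra P B] [Algebra.IsIntegral P B] (q : Ideal B) [q.IsPrime]
    (h : q.comap (algebraMap P B) = ⊥) : q ∈ minimalPrimes B := by
  refine ⟨⟨inferInstance, bot_le⟩, fun q' ⟨hq', _⟩ hle => ?_⟩
  by_contra hn
  have := Ideal.IsIntegral.comap_lt_comap (R := P) (lt_of_le_not_ge hle hn)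
  rw [h] at this
  exact not_lt_bot this

section

variable {P : Type*} [CommRing P] [IsDomain P] {d : ℕ}

theorem PrimeSpectrum.bot_lt_of_asIdeal_ne_bot {p : PrimeSpectrum P} (h : p.asIdeal ≠ ⊥) :
    ⊥ < p :=
  bot_lt_iff_ne_bot.mpr fun h0 => h (by rw [h0]; rfl)

/-- If `P → B` has a nonzero kernel, every prime of `B` lies over a nonzero prime of `P`, so chains
of primes of `B` are strictly shorter than the dimension of `P`. -/
theorem algebraMap_injective_of_isIntegral_of_ringKrullDim_eq (hP : ringKrullDim P = d)
    {B : Type*} [CommRing B] [Algebra P B] [Algebra.IsIntegral P B] (hB : ringKrullDim B = d) :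
    Function.Injective (algebraMap P B) := by
  rw [RingHom.injective_iff_ker_eq_bot]
  by_contra h
  refine absurd hB (Order.krullDim_lt_of_strictMono_of_forall_lt hP _
    (PrimeSpectrum.comap_strictMono_of_isIntegral (R := P) (S := B)) ⊥ fun q => ?_).ne
  refine PrimeSpectrum.bot_lt_of_asIdeal_ne_bot fun h0 => h (le_bot_iff.mp ?_)
  rw [← h0]
  exact Ideal.ker_le_comap _

variable {B : Type*} [CommRing B] [Algebra P B] [Algebra.IsIntegral P B]

/-- The primes of maximal dimension are those over the generic point of `P`. -/
theorem Ideal.comap_eq_bot_iff_ringKrullDim_quotient_eq (hP : ringKrullDim P = d) (q : Ideal B)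
    [q.IsPrime] : q.comap (algebraMap P B) = ⊥ ↔ ringKrullDim (B ⧸ q) = d := by
  have hker : RingHom.ker (algebraMap P (B ⧸ q)) = q.comap (algebraMap P B) := by
    rw [IsScalarTower.algebraMap_eq P B (B ⧸ q), ← RingHom.comap_ker, Ideal.Quotient.algebraMap_eq,
      Ideal.mk_ker]
  constructor
  · intro h
    refine le_antisymm ?_ ?_
    · rw [← hP]
      exact Order.krullDim_le_of_strictMono _
        (PrimeSpectrum.comap_strictMono_of_isIntegral (R := P) (S := B ⧸ q))
    · rw [← hP]
      refine ringKrullDim_le_of_isIntegral_of_injective ?_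
      rw [RingHom.injective_iff_ker_eq_bot, hker, h]
  · intro h
    rw [← hker, ← RingHom.injective_iff_ker_eq_bot]
    exact algebraMap_injective_of_isIntegral_of_ringKrullDim_eq hP h

/-- For `B` integral over a domain `P` of dimension `d`, a `B`-module has support of dimension less
than `d` if and only if no prime of its support lies over the zero ideal of `P`. -/
theorem Module.supportDim_lt_iff_forall_comap_ne_bot (hP : ringKrullDim P = d) (M : Type*)
    [AddCommGroup M] [Module B M] : Module.supportDim B M < d ↔
      ∀ p ∈ Module.support B M, p.asIdeal.comap (algebraMap P B) ≠ ⊥ := by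
  constructor
  · intro h p hp h0
    refine absurd h (not_lt.mpr ?_)
    rw [← (Ideal.comap_eq_bot_iff_ringKrullDim_quotient_eq hP p.asIdeal).mp h0]
    let f : PrimeSpectrum (B ⧸ p.asIdeal) → Module.support B M := fun x =>
      ⟨PrimeSpectrum.comap (Ideal.Quotient.mk p.asIdeal) x, Module.mem_support_mono
        (p := p) (by
          change p.asIdeal ≤ _
          conv_lhs => rw [← Ideal.mk_ker (I := p.asIdeal)]
          exact Ideal.ker_le_comap _) hp⟩
    exact Order.krullDim_le_of_strictMono f fun a b hab =>
      (PrimeSpectrum.comap_strictMono_of_isIntegral (R := B) (S := B ⧸ p.asIdeal)) hab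
  · intro h
    exact Order.krullDim_lt_of_strictMono_of_forall_lt hP
      (fun p : Module.support B M => PrimeSpectrum.comap (algebraMap P B) p.1)
      (fun _ _ hab => PrimeSpectrum.comap_strictMono_of_isIntegral hab) ⊥
      fun p => PrimeSpectrum.bot_lt_of_asIdeal_ne_bot (h p.1 p.2)

end

/-! ### Reductions and finiteness of general projections -/

/-- The `k`-subspace of `B` spanned by `1` and the members of the family `l`. -/
def unitalSpan (k : Type*) {B ι : Type*} [Field k] [CommRing B] [Algebra k B] (l : ι → B) :
    Submodule k B :=
  1 ⊔ Submodule.span k (Set.range l)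

/-- A subspace `Λ` of `W` is a reduction of `W` if `W ^ (D + 1) = Λ * W ^ D` for some `D`; only the
nontrivial inclusion is recorded. -/
def IsReduction {k B : Type*} [Field k] [CommRing B] [Algebra k B] (Λ W : Submodule k B) : Prop :=
  Λ ≤ W ∧ ∃ D : ℕ, W ^ (D + 1) ≤ Λ * W ^ D

section

variable {k B : Type*} [Field k] [CommRing B] [Algebra k B]

theorem one_le_unitalSpan {ι : Type*} (l : ι → B) : 1 ≤ unitalSpan k l := le_sup_left

theorem mem_unitalSpan {ι : Type*} (l : ι → B) (i : ι) : l i ∈ unitalSpan k l :=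
  le_sup_right (a := (1 : Submodule k B)) (Submodule.subset_span ⟨i, rfl⟩)

theorem unitalSpan_le_iff {ι : Type*} {l : ι → B} {N : Submodule k B} :
    unitalSpan k l ≤ N ↔ 1 ≤ N ∧ ∀ i, l i ∈ N := by
  rw [unitalSpan, sup_le_iff, Submodule.span_le, Set.range_subset_iff]
  rfl

theorem unitalSpan_le_unitalSpan {ι κ : Type*} {l : ι → B} {l' : κ → B}
    (h : ∀ i, l i ∈ Submodule.span k (Set.range l')) : unitalSpan k l ≤ unitalSpan k l' :=
  unitalSpan_le_iff.mpr ⟨one_le_unitalSpan l',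
    fun i => le_sup_right (a := (1 : Submodule k B)) (h i)⟩

theorem unitalSpan_fg {ι : Type*} [Finite ι] (l : ι → B) : (unitalSpan k l).FG :=
  Submodule.FG.sup ⟨{1}, by simp [Submodule.one_eq_span]⟩ (Submodule.fg_span (Set.finite_range l))

theorem pow_add_le_pow_mul_pow {Λ W : Submodule k B} {D : ℕ} (h : W ^ (D + 1) ≤ Λ * W ^ D)
    (e : ℕ) : W ^ (D + e) ≤ Λ ^ e * W ^ D := by
  induction e with
  | zero => simp
  | succ e ih =>
    calc W ^ (D + (e + 1)) = W * W ^ (D + e) := by rw [← add_assoc, pow_succ']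
      _ ≤ W * (Λ ^ e * W ^ D) := mul_le_mul_right ih _
      _ = Λ ^ e * W ^ (D + 1) := by ring
      _ ≤ Λ ^ e * (Λ * W ^ D) := mul_le_mul_right h _
      _ = Λ ^ (e + 1) * W ^ D := by ring

theorem IsReduction.refl (W : Submodule k B) : IsReduction W W :=
  ⟨le_rfl, 0, by simp⟩

theorem IsReduction.trans {Λ' Λ W : Submodule k B} (h' : IsReduction Λ' Λ) (h : IsReduction Λ W) :
    IsReduction Λ' W := by
  obtain ⟨hΛ', E, hE⟩ := h'
  obtain ⟨hΛ, D, hD⟩ := h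
  refine ⟨hΛ'.trans hΛ, D + E, ?_⟩
  calc W ^ (D + E + 1) ≤ Λ ^ (E + 1) * W ^ D := pow_add_le_pow_mul_pow hD (E + 1)
    _ ≤ Λ' * Λ ^ E * W ^ D := mul_le_mul_left hE _
    _ ≤ Λ' * W ^ E * W ^ D := mul_le_mul_left (mul_le_mul_right (pow_le_pow_left' hΛ E) _) _
    _ = Λ' * W ^ (D + E) := by ring

theorem exists_mem_unitalSpan_pow {ι : Type*} {y : ι → B}
    (hy : Algebra.adjoin k (Set.range y) = ⊤) (b : B) : ∃ e, b ∈ unitalSpan k y ^ e := by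
  have hb : b ∈ Algebra.adjoin k (Set.range y) := hy ▸ Algebra.mem_top
  have h1 := one_le_unitalSpan (k := k) y
  induction hb using Algebra.adjoin_induction with
  | mem x hx =>
    obtain ⟨i, rfl⟩ := hx
    exact ⟨1, by simpa using mem_unitalSpan y i⟩
  | algebraMap r => exact ⟨0, by simp⟩
  | add a b _ _ ha hb =>
    obtain ⟨e, he⟩ := ha
    obtain ⟨f, hf⟩ := hb
    exact ⟨max e f, add_mem (pow_le_pow_right' h1 (le_max_left e f) he)
      (pow_le_pow_right' h1 (le_max_right e f) hf)⟩
  | mul a b _ _ ha hb =>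
    obtain ⟨e, he⟩ := ha
    obtain ⟨f, hf⟩ := hb
    exact ⟨e + f, by rw [pow_add]; exact Submodule.mul_mem_mul he hf⟩

/-- An algebra generated by `W` is finite over every subalgebra containing a reduction of `W`. -/
theorem IsReduction.finite {ι : Type*} [Finite ι] {y : ι → B}
    (hy : Algebra.adjoin k (Set.range y) = ⊤) {Λ : Submodule k B}
    (h : IsReduction Λ (unitalSpan k y)) {A : Subalgebra k B} (hA : Λ ≤ Subalgebra.toSubmodule A) :
    Module.Finite A B := by
  obtain ⟨-, D, hD⟩ := h
  obtain ⟨S, hS⟩ := (unitalSpan_fg (k := k) y).pow D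
  refine ⟨⟨S, ?_⟩⟩
  rw [eq_top_iff]
  rintro b -
  obtain ⟨e, he⟩ := exists_mem_unitalSpan_pow hy b
  have h2 : b ∈ Λ ^ e * unitalSpan k y ^ D :=
    pow_add_le_pow_mul_pow hD e (pow_le_pow_right' (one_le_unitalSpan y) (Nat.le_add_left e D) he)
  have h3 : Λ ^ e ≤ Subalgebra.toSubmodule A := by
    clear h2 he
    induction e with
    | zero => rw [pow_zero, Submodule.one_le]; exact one_mem A
    | succ e ih =>
      rw [pow_succ]
      exact Submodule.mul_le.mpr fun a ha b hb => A.mul_mem (ih ha) (hA hb)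
  refine Submodule.mul_induction_on h2 (fun a ha w hw => ?_) fun _ _ => add_mem
  rw [← hS] at hw
  have hw' : w ∈ Submodule.span A (S : Set B) := Submodule.span_subset_span k A _ hw
  exact (Submodule.span A (S : Set B)).smul_mem ⟨a, h3 ha⟩ hw'

theorem Finsupp.prod_map_toMultiset {ι M : Type*} [CommMonoid M] (g : ι → M) (α : ι →₀ ℕ) :
    (α.toMultiset.map g).prod = α.prod fun i e => g i ^ e := by
  rw [toMultiset_map, prod_toMultiset, prod_mapDomain_index]
  exacts [fun _ => pow_zero _, fun _ _ _ => pow_add _ _ _]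

/-- Replacing `z i` by `μ i * t` in a monomial of degree at most `e + 1` changes it by an element
of `Λ' * Λ ^ e`, when the differences `z i - μ i * t` lie in `Λ'`. -/
theorem prod_sub_prod_mul_pow_mem {ι : Type*} {Λ' Λ : Submodule k B} (h1 : 1 ≤ Λ)
    {z : ι → B} (hz : ∀ i, z i ∈ Λ) {t : B} (ht : t ∈ Λ) {μ : ι → k}
    (hw : ∀ i, z i - μ i • t ∈ Λ') (s : Multiset ι) (e : ℕ) (hs : s.card ≤ e + 1) :
    (s.map z).prod - (s.map μ).prod • t ^ s.card ∈ Λ' * Λ ^ e := by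
  induction s using Multiset.induction_on generalizing e with
  | empty => simp
  | cons a s ih =>
    simp only [Multiset.card_cons, add_le_add_iff_right] at hs
    have hprod : (s.map z).prod ∈ Λ ^ e := by
      refine pow_le_pow_right' h1 hs ?_
      clear ih hs
      induction s using Multiset.induction_on with
      | empty =>
        rw [Multiset.map_zero, Multiset.prod_zero, Multiset.card_zero, pow_zero]
        exact Submodule.one_le.mp le_rfl
      | cons a s ih =>
        rw [Multiset.map_cons, Multiset.prod_cons, Multiset.card_cons, pow_succ']
        exact Submodule.mul_mem_mul (hz a) ih
    have hrest : t * ((s.map z).prod - (s.map μ).prod • t ^ s.card) ∈ Λ' * Λ ^ e := by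
      rcases e with _ | e
      · obtain rfl : s = 0 := Multiset.card_eq_zero.mp (Nat.le_zero.mp hs)
        simp
      · rw [pow_succ', mul_left_comm]
        exact Submodule.mul_mem_mul ht (ih e hs)
    have : ((a ::ₘ s).map z).prod - ((a ::ₘ s).map μ).prod • t ^ (a ::ₘ s).card =
        (z a - μ a • t) * (s.map z).prod +
          μ a • (t * ((s.map z).prod - (s.map μ).prod • t ^ s.card)) := by
      simp only [Multiset.map_cons, Multiset.prod_cons, Multiset.card_cons, Algebra.smul_def,
        map_mul]
      ring
    rw [this]
    exact add_mem (Submodule.mul_mem_mul (hw a) hprod) (Submodule.smul_mem _ _ hrest)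

open MvPolynomial in
/-- An algebraically dependent family of `m + 1` elements has a reduction spanned by `m` linear
combinations: project from a point off the hypersurface at infinity of a relation. -/
theorem exists_isReduction_of_not_algebraicIndependent [Infinite k] [Nontrivial B] {m : ℕ}
    (z : Fin (m + 1) → B) (hz : ¬ AlgebraicIndependent k z) :
    ∃ z' : Fin m → B, (∀ i, z' i ∈ Submodule.span k (Set.range z)) ∧
      IsReduction (unitalSpan k z') (unitalSpan k z) := by
  classical
  rw [algebraicIndependent_iff] at hz
  push Not at hz
  obtain ⟨F, hF, hF0⟩ := hz
  obtain ⟨E, hE⟩ : ∃ E, F.totalDegree = E + 1 := by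
    refine Nat.exists_eq_succ_of_ne_zero fun h0 => hF0 ?_
    rw [totalDegree_eq_zero_iff_eq_C] at h0
    rw [h0, aeval_C, map_eq_zero_iff _ (algebraMap k B).injective] at hF
    rw [h0, hF, C_0]
  -- `v` is a point where the leading form `G` of the relation does not vanish; `μ` is the same
  -- point of projective space, normalized so that `μ j = 1`
  let G := homogeneousComponent (E + 1) F
  have hG0 : G ≠ 0 := by
    obtain ⟨α, hα, hdeg⟩ := Finset.exists_mem_eq_sup F.support (support_nonempty.mpr hF0)
      fun α => α.sum fun _ e => e
    refine ne_zero_iff.mpr ⟨α, ?_⟩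
    rw [coeff_homogeneousComponent, if_pos, ← mem_support_iff]
    · exact hα
    · rw [← hE]; exact hdeg.symm
  have hG : G.IsHomogeneous (E + 1) := homogeneousComponent_isHomogeneous _ _
  obtain ⟨v, hv⟩ : ∃ v, eval v G ≠ 0 := by
    by_contra! h0
    exact hG0 (MvPolynomial.funext fun x => by simpa using h0 x)
  obtain ⟨j, hj⟩ : ∃ j, v j ≠ 0 := by
    by_contra! h0
    rw [show v = 0 from funext h0, eval_zero, constantCoeff_eq] at hv
    exact hv (hG.coeff_eq_zero (by simp))
  let μ : Fin (m + 1) → k := fun i => (v j)⁻¹ * v i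
  have hμ : eval μ G ≠ 0 := by
    have : eval μ G = (v j)⁻¹ ^ (E + 1) * eval v G := by
      rw [eval_eq, eval_eq, Finset.mul_sum]
      refine Finset.sum_congr rfl fun α hα => ?_
      have hdeg : α.degree = E + 1 := by
        rw [Finsupp.degree_eq_weight_one]
        exact hG (mem_support_iff.mp hα)
      rw [← hdeg, Finsupp.degree_apply]
      simp only [μ, mul_pow, Finset.prod_mul_distrib, Finset.prod_pow_eq_pow_sum]
      ring
    rw [this]
    exact mul_ne_zero (pow_ne_zero _ (inv_ne_zero hj)) hv
  set t := z j with ht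
  let w : Fin (m + 1) → B := fun i => z i - μ i • t
  have hwj : w j = 0 := by simp [w, μ, hj, ht]
  let z' : Fin m → B := fun i => w (j.succAbove i)
  set Λ := unitalSpan k z with hΛ
  set Λ' := unitalSpan k z' with hΛ'
  have hw (i) : w i ∈ Λ' := by
    rcases Fin.eq_self_or_eq_succAbove j i with rfl | ⟨a, rfl⟩
    · rw [hwj]; exact zero_mem _
    · exact mem_unitalSpan z' a
  have hz' (i) : z' i ∈ Submodule.span k (Set.range z) :=
    sub_mem (Submodule.subset_span ⟨_, rfl⟩)
      (Submodule.smul_mem _ _ (Submodule.subset_span ⟨_, rfl⟩))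
  have h1 : 1 ≤ Λ := one_le_unitalSpan z
  have h1' : 1 ≤ Λ' := one_le_unitalSpan z'
  have htΛ : t ∈ Λ := mem_unitalSpan z j
  -- substituting `z i = w i + μ i • t` in the relation leaves `G(μ) • t ^ (E + 1)` modulo terms
  -- that contain some `w i` or have lower degree
  have htop : t ^ (E + 1) ∈ Λ' * Λ ^ E := by
    let T (α : Fin (m + 1) →₀ ℕ) : B := coeff α F • (α.prod fun i e => μ i ^ e) • t ^ α.degree
    have hdeg {α} (hα : α ∈ F.support) : α.degree ≤ E + 1 := hE ▸ le_totalDegree hα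
    have hcard (α : Fin (m + 1) →₀ ℕ) : (Finsupp.toMultiset α).card = α.degree := by
      rw [Finsupp.card_toMultiset]; rfl
    have hT : ∑ α ∈ F.support, T α ∈ Λ' * Λ ^ E := by
      have : ∑ α ∈ F.support, T α =
          - ∑ α ∈ F.support, (coeff α F • (α.prod fun i e => z i ^ e) - T α) := by
        have hF' : ∑ α ∈ F.support, coeff α F • (α.prod fun i e => z i ^ e) = 0 := by
          rw [← hF, aeval_def, eval₂_eq]
          exact Finset.sum_congr rfl fun α _ => Algebra.smul_def _ _
        rw [Finset.sum_sub_distrib, hF', zero_sub, neg_neg]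
      rw [this]
      refine neg_mem (sum_mem fun α hα => ?_)
      rw [← smul_sub]
      refine Submodule.smul_mem _ _ ?_
      have := prod_sub_prod_mul_pow_mem h1 (mem_unitalSpan z) htΛ hw (Finsupp.toMultiset α) E
        (by rw [hcard]; exact hdeg hα)
      rwa [hcard, Finsupp.prod_map_toMultiset, Finsupp.prod_map_toMultiset] at this
    have hlow : ∑ α ∈ F.support with ¬ α.degree = E + 1, T α ∈ Λ' * Λ ^ E := by
      refine sum_mem fun α hα => ?_
      rw [Finset.mem_filter] at hα
      refine Submodule.smul_mem _ _ (Submodule.smul_mem _ _ ?_)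
      have h2 : α.degree ≤ E := Nat.le_of_lt_succ (lt_of_le_of_ne (hdeg hα.1) hα.2)
      rw [← one_mul (t ^ _)]
      exact Submodule.mul_mem_mul (Submodule.one_le.mp h1')
        (pow_le_pow_right' h1 h2 (Submodule.pow_mem_pow _ htΛ _))
    rw [← Finset.sum_filter_add_sum_filter_not _ (fun α => α.degree = E + 1)] at hT
    have htopsum := (Submodule.add_mem_iff_left _ hlow).mp hT
    have : ∑ α ∈ F.support with α.degree = E + 1, T α = eval μ G • t ^ (E + 1) := by
      simp only [G, homogeneousComponent_apply, map_sum, Finset.sum_smul]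
      refine Finset.sum_congr rfl fun α hα => ?_
      rw [eval_monomial, mul_smul, ← (Finset.mem_filter.mp hα).2]
    rw [this] at htopsum
    exact (Submodule.smul_mem_iff _ hμ).mp htopsum
  have hsup : Λ ≤ Λ' ⊔ Submodule.span k {t} := by
    refine unitalSpan_le_iff.mpr ⟨h1'.trans le_sup_left, fun i => ?_⟩
    have : z i = w i + μ i • t := by simp [w]
    rw [this]
    exact Submodule.add_mem_sup (hw i)
      (Submodule.smul_mem _ _ (Submodule.mem_span_singleton_self t))
  have hpow (e : ℕ) : Λ ^ (e + 1) ≤ Λ' * Λ ^ e ⊔ Submodule.span k {t ^ (e + 1)} := by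
    induction e with
    | zero => simpa using hsup
    | succ e ih =>
      calc Λ ^ (e + 1 + 1) = Λ ^ (e + 1) * Λ := pow_succ _ _
        _ ≤ (Λ' * Λ ^ e ⊔ Submodule.span k {t ^ (e + 1)}) * Λ := mul_le_mul_left ih _
        _ = Λ' * Λ ^ (e + 1) ⊔ Submodule.span k {t ^ (e + 1)} * Λ := by
          rw [Submodule.sup_mul, mul_assoc, ← pow_succ]
        _ ≤ Λ' * Λ ^ (e + 1) ⊔ Submodule.span k {t ^ (e + 1)} * (Λ' ⊔ Submodule.span k {t}) :=
          sup_le_sup_left (mul_le_mul_right hsup _) _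
        _ ≤ _ := by
          rw [Submodule.mul_sup, Submodule.span_mul_span, Set.singleton_mul_singleton, ← pow_succ,
            ← sup_assoc]
          refine sup_le_sup_right (sup_le le_rfl ?_) _
          rw [mul_comm]
          refine mul_le_mul_right ?_ _
          rw [Submodule.span_singleton_le_iff_mem]
          exact Submodule.pow_mem_pow _ htΛ _
  refine ⟨z', hz', unitalSpan_le_unitalSpan hz', E, (hpow E).trans (sup_le le_rfl ?_)⟩
  rwa [Submodule.span_singleton_le_iff_mem]

/-- An algebra of dimension `d` has a linear Noether normalization: the span of a generating family
and `1` has a reduction spanned by `1` and `d` linear combinations of the generators. -/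
theorem exists_isReduction_of_ringKrullDim_eq [Infinite k] {n d : ℕ} {y : Fin n → B}
    (hy : Algebra.adjoin k (Set.range y) = ⊤) (hd : ringKrullDim B = d) :
    ∃ z : Fin d → B, (∀ i, z i ∈ Submodule.span k (Set.range y)) ∧
      IsReduction (unitalSpan k z) (unitalSpan k y) := by
  have : Nontrivial B := by
    by_contra h
    rw [not_nontrivial_iff_subsingleton] at h
    rw [ringKrullDim_eq_bot_of_subsingleton] at hd
    exact absurd hd (WithBot.bot_ne_coe)
  have hdn : d ≤ n := by
    let φ : MvPolynomial (Fin n) k →ₐ[k] B := MvPolynomial.aeval y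
    have hsurj : Function.Surjective φ := by
      rw [← AlgHom.range_eq_top, ← Algebra.adjoin_range_eq_range_aeval, hy]
    have := ringKrullDim_le_of_surjective φ.toRingHom hsurj
    rw [hd, MvPolynomial.ringKrullDim_fin] at this
    exact_mod_cast this
  refine Nat.decreasingInduction' (P := fun m => ∃ z : Fin m → B,
    (∀ i, z i ∈ Submodule.span k (Set.range y)) ∧ IsReduction (unitalSpan k z) (unitalSpan k y))
    (fun m _ hm ih => ?_) hdn ⟨y, fun i => Submodule.subset_span ⟨i, rfl⟩, .refl _⟩
  obtain ⟨z, hzy, hz⟩ := ih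
  obtain ⟨z', hz'z, hz'⟩ := exists_isReduction_of_not_algebraicIndependent z (by
    intro hind
    let A := Algebra.adjoin k (Set.range z)
    have hA : unitalSpan k z ≤ Subalgebra.toSubmodule A :=
      unitalSpan_le_iff.mpr ⟨Submodule.one_le.mpr (one_mem A),
        fun i => Algebra.subset_adjoin ⟨i, rfl⟩⟩
    have := hz.finite hy hA
    have h1 := ringKrullDim_le_of_isIntegral_of_injective (R := A) (S := B)
      Subtype.val_injective
    rw [← ringKrullDim_eq_of_ringEquiv hind.aevalEquiv.toRingEquiv, MvPolynomial.ringKrullDim_fin,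
      hd] at h1
    have h2 : m + 1 ≤ d := by exact_mod_cast h1
    omega)
  exact ⟨z', fun i => (Submodule.span_le.mpr (Set.range_subset_iff.mpr hzy)) (hz'z i),
    hz'.trans hz⟩

variable {m n : ℕ}

/-- The linear combinations `∑ j, c (i, j) • y j` with coefficient matrix `c`. -/
def linearCombinations (y : Fin n → B) (c : Fin m × Fin n → k) (i : Fin m) : B :=
  ∑ j, c (i, j) • y j

theorem linearCombinations_mem_span (y : Fin n → B) (c : Fin m × Fin n → k) (i : Fin m) :
    linearCombinations y c i ∈ Submodule.span k (Set.range y) :=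
  sum_mem fun j _ => Submodule.smul_mem _ _ (Submodule.subset_span ⟨j, rfl⟩)

theorem linearCombinations_mem_adjoin (y : Fin n → B) (c : Fin m × Fin n → k) (i : Fin m) :
    linearCombinations y c i ∈ linearCombinationSubalgebra y c :=
  Algebra.subset_adjoin ⟨i, rfl⟩

theorem exists_eq_linearCombinations {y : Fin n → B} {z : Fin m → B}
    (hz : ∀ i, z i ∈ Submodule.span k (Set.range y)) :
    ∃ c : Fin m × Fin n → k, z = linearCombinations y c := by
  simp only [Submodule.mem_span_range_iff_exists_fun] at hz
  choose c hc using hz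
  exact ⟨fun p => c p.1 p.2, funext fun i => (hc i).symm⟩

/-- The part independent of `c` of the generators `w` and `linearCombinations y c i * w`, for `w` in
`W ^ D`, of the subspace `Λ * W ^ D` of `W ^ (D + 1)`, where `W` and `Λ` are spanned by `1` and by
`y`, respectively by `linearCombinations y c`. -/
def reductionConst (k : Type*) {B : Type*} [Field k] [CommRing B] [Algebra k B] {n : ℕ}
    (y : Fin n → B) (m D : ℕ) :
    (unitalSpan k y ^ D : Submodule k B) × Option (Fin m) →
      (unitalSpan k y ^ (D + 1) : Submodule k B)
  | (w, none) => ⟨w, pow_le_pow_right' (one_le_unitalSpan y) D.le_succ w.2⟩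
  | (_, some _) => 0

/-- The part linear in `c` of the generators described at `reductionConst`. -/
def reductionLin (k : Type*) {B : Type*} [Field k] [CommRing B] [Algebra k B] {n : ℕ}
    (y : Fin n → B) (m D : ℕ) :
    (unitalSpan k y ^ D : Submodule k B) × Option (Fin m) → Fin m × Fin n →
      (unitalSpan k y ^ (D + 1) : Submodule k B)
  | (_, none), _ => 0
  | (w, some i), τ => if τ.1 = i then
      ⟨y τ.2 * w, by rw [pow_succ']; exact Submodule.mul_mem_mul (mem_unitalSpan y _) w.2⟩ else 0

theorem coe_reductionLin_some (y : Fin n → B) (D : ℕ) (w : (unitalSpan k y ^ D : Submodule k B))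
    (i : Fin m) (τ : Fin m × Fin n) :
    (reductionLin k y m D (w, some i) τ : B) = if τ.1 = i then y τ.2 * w else 0 := by
  rw [reductionLin]
  split_ifs <;> rfl

theorem coe_reductionConst_add_none (y : Fin n → B) (D : ℕ) (c : Fin m × Fin n → k)
    (w : (unitalSpan k y ^ D : Submodule k B)) :
    ((reductionConst k y m D (w, none) + ∑ τ, c τ • reductionLin k y m D (w, none) τ :
      (unitalSpan k y ^ (D + 1) : Submodule k B)) : B) = w := by
  simp [reductionConst, reductionLin]

theorem coe_reductionConst_add_some (y : Fin n → B) (D : ℕ) (c : Fin m × Fin n → k)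
    (w : (unitalSpan k y ^ D : Submodule k B)) (i : Fin m) :
    ((reductionConst k y m D (w, some i) + ∑ τ, c τ • reductionLin k y m D (w, some i) τ :
      (unitalSpan k y ^ (D + 1) : Submodule k B)) : B) = linearCombinations y c i * w := by
  simp only [reductionConst, zero_add, AddSubmonoidClass.coe_finsetSum, SetLike.val_smul,
    coe_reductionLin_some]
  rw [Fintype.sum_prod_type, Finset.sum_eq_single i]
  · simp [linearCombinations, Finset.sum_mul]
  · intro a _ ha
    simp [ha]
  · simp

theorem span_reduction_eq_top_iff (y : Fin n → B) (D : ℕ) (c : Fin m × Fin n → k) :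
    Submodule.span k (Set.range fun a => reductionConst k y m D a +
      ∑ τ, c τ • reductionLin k y m D a τ) = ⊤ ↔
      unitalSpan k y ^ (D + 1) ≤ unitalSpan k (linearCombinations y c) * unitalSpan k y ^ D := by
  have h : (Submodule.span k (Set.range fun a => reductionConst k y m D a +
      ∑ τ, c τ • reductionLin k y m D a τ)).map (Submodule.subtype _) =
      unitalSpan k (linearCombinations y c) * unitalSpan k y ^ D := by
    apply le_antisymm
    · rw [Submodule.map_span_le]
      rintro _ ⟨⟨w, _ | i⟩, rfl⟩
      · rw [Submodule.subtype_apply, coe_reductionConst_add_none, ← one_mul (w : B)]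
        exact Submodule.mul_mem_mul (Submodule.one_le.mp (one_le_unitalSpan _)) w.2
      · rw [Submodule.subtype_apply, coe_reductionConst_add_some]
        exact Submodule.mul_mem_mul (mem_unitalSpan _ i) w.2
    · have key (w) (hw : w ∈ unitalSpan k y ^ D) (x)
          (hx : x ∈ unitalSpan k (linearCombinations y c)) : x * w ∈
          (Submodule.span k (Set.range fun a => reductionConst k y m D a +
            ∑ τ, c τ • reductionLin k y m D a τ)).map (Submodule.subtype _) := by
        have : unitalSpan k (linearCombinations y c) ≤
            ((Submodule.span k (Set.range fun a => reductionConst k y m D a +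
            ∑ τ, c τ • reductionLin k y m D a τ)).map (Submodule.subtype _)).comap
              (LinearMap.mulRight k w) := by
          refine unitalSpan_le_iff.mpr ⟨Submodule.one_le.mpr ?_, fun i => ?_⟩
          · exact ⟨_, Submodule.subset_span ⟨(⟨w, hw⟩, none), rfl⟩, by
              rw [Submodule.subtype_apply, coe_reductionConst_add_none]; simp⟩
          · exact ⟨_, Submodule.subset_span ⟨(⟨w, hw⟩, some i), rfl⟩, by
              rw [Submodule.subtype_apply, coe_reductionConst_add_some]; simp⟩
        exact this hx
      exact Submodule.mul_le.mpr fun x hx w hw => key w hw x hx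
  rw [← h]
  constructor
  · intro h0
    rw [h0, Submodule.map_top, Submodule.range_subtype]
  · intro h0
    rw [eq_top_iff]
    rintro ⟨x, hx⟩ -
    obtain ⟨x', hx', hxx'⟩ := h0 hx
    obtain rfl : x' = ⟨x, hx⟩ := Subtype.ext hxx'
    exact hx'

instance finite_unitalSpan_pow (y : Fin n → B) (D : ℕ) :
    Module.Finite k (unitalSpan k y ^ D : Submodule k B) :=
  Module.Finite.iff_fg.mpr ((unitalSpan_fg y).pow D)

/-- The linear Noether normalization theorem: `dim B` general linear combinations of generators
span, with `1`, a reduction. -/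
theorem forGeneral_isReduction [Infinite k] {d : ℕ} {y : Fin n → B}
    (hy : Algebra.adjoin k (Set.range y) = ⊤) (hd : ringKrullDim B = d) :
    ForGeneral fun c : Fin d × Fin n → k =>
      IsReduction (unitalSpan k (linearCombinations y c)) (unitalSpan k y) := by
  obtain ⟨z, hz, -, D, hD⟩ := exists_isReduction_of_ringKrullDim_eq hy hd
  obtain ⟨c₀, rfl⟩ := exists_eq_linearCombinations hz
  refine (ForGeneral.span_affine_eq_top _ _ c₀ ((span_reduction_eq_top_iff y D c₀).mpr hD)).mono
    fun c hc => ⟨unitalSpan_le_unitalSpan (linearCombinations_mem_span y c), D, ?_⟩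
  exact (span_reduction_eq_top_iff y D c).mp hc

end

/-! ### Differentials at a prime and the embedding dimension -/

theorem Ideal.exists_notMem_forall_smul_eq_zero_iff {B M : Type*} [CommRing B] [AddCommGroup M]
    [Module B M] [Module.Finite B M] (q : Ideal B) [q.IsPrime] :
    (∃ h ∉ q, ∀ x : M, h • x = 0) ↔ Subsingleton (q.ResidueField ⊗[B] M) := by
  rw [← not_nontrivial_iff_subsingleton,
    ← Module.mem_support_iff_nontrivial_residueField_tensorProduct (p := ⟨q, inferInstance⟩),
    Module.mem_support_iff_of_finite, SetLike.not_le_iff_exists]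
  simp only [Module.mem_annihilator]
  exact ⟨fun ⟨h, h1, h2⟩ => ⟨h, h2, h1⟩, fun ⟨h, h1, h2⟩ => ⟨h, h2, h1⟩⟩

/-- A family spans the fibre at `q` of a finite module if and only if it generates the module after
inverting a single element outside `q`. -/
theorem Ideal.span_one_tmul_eq_top_iff {B M ι : Type*} [CommRing B] [AddCommGroup M]
    [Module B M] [Module.Finite B M] (q : Ideal B) [q.IsPrime] (w : ι → M) :
    Submodule.span q.ResidueField (Set.range fun i => (1 : q.ResidueField) ⊗ₜ[B] w i) = ⊤ ↔
      ∃ h ∉ q, ∀ x : M, h • x ∈ Submodule.span B (Set.range w) := by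
  let N := Submodule.span B (Set.range w)
  constructor
  · intro hspan
    have : Subsingleton (q.ResidueField ⊗[B] (M ⧸ N)) := by
      have h0 : LinearMap.baseChange q.ResidueField N.mkQ = 0 := by
        refine LinearMap.ext_on_range hspan fun i => ?_
        rw [LinearMap.baseChange_tmul, Submodule.mkQ_apply,
          (Submodule.Quotient.mk_eq_zero N).mpr (Submodule.subset_span ⟨i, rfl⟩), tmul_zero]
        rfl
      refine subsingleton_of_forall_eq 0 fun x => ?_
      obtain ⟨x, rfl⟩ := LinearMap.lTensor_surjective q.ResidueField N.mkQ_surjective x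
      exact LinearMap.congr_fun h0 x
    obtain ⟨h, hq, hh⟩ := (Ideal.exists_notMem_forall_smul_eq_zero_iff q).mpr this
    exact ⟨h, hq, fun x => (Submodule.Quotient.mk_eq_zero N).mp (hh (Submodule.Quotient.mk x))⟩
  · rintro ⟨h, hq, hh⟩
    rw [eq_top_iff]
    rintro x -
    have hne : algebraMap B q.ResidueField h ≠ 0 := fun h0 =>
      hq (Ideal.algebraMap_residueField_eq_zero.mp h0)
    have hN (x : M) (hx : x ∈ N) : (1 : q.ResidueField) ⊗ₜ[B] x ∈
        Submodule.span q.ResidueField (Set.range fun i => (1 : q.ResidueField) ⊗ₜ[B] w i) := by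
      induction hx using Submodule.span_induction with
      | mem x hx => obtain ⟨i, rfl⟩ := hx; exact Submodule.subset_span ⟨i, rfl⟩
      | zero => rw [tmul_zero]; exact zero_mem _
      | add x y _ _ hx hy => rw [tmul_add]; exact add_mem hx hy
      | smul a x _ hx =>
        rw [tmul_smul, ← algebraMap_smul q.ResidueField]
        exact Submodule.smul_mem _ _ hx
    induction x with
    | zero => exact zero_mem _
    | add x y hx hy => exact add_mem hx hy
    | tmul a x =>
      have := hN _ (hh x)
      rw [tmul_smul, ← algebraMap_smul q.ResidueField, Submodule.smul_mem_iff _ hne] at this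
      rw [← mul_one a, ← smul_eq_mul, ← smul_tmul']
      exact Submodule.smul_mem _ _ this

namespace KaehlerDifferential

theorem span_range_D_eq_top_of_adjoin_eq_top {R S ι : Type*} [CommRing R] [CommRing S]
    [Algebra R S] {x : ι → S} (hx : Algebra.adjoin R (Set.range x) = ⊤) :
    Submodule.span S (Set.range fun i => D R S (x i)) = ⊤ := by
  rw [eq_top_iff, ← span_range_derivation, Submodule.span_le]
  rintro _ ⟨b, rfl⟩
  have hb : b ∈ Algebra.adjoin R (Set.range x) := hx ▸ Algebra.mem_top
  rw [SetLike.mem_coe]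
  induction hb using Algebra.adjoin_induction with
  | mem x hx => obtain ⟨i, rfl⟩ := hx; exact Submodule.subset_span ⟨i, rfl⟩
  | algebraMap r => rw [Derivation.map_algebraMap]; exact zero_mem _
  | add a b _ _ ha hb => rw [map_add]; exact add_mem ha hb
  | mul a b _ _ ha hb =>
    rw [Derivation.leibniz]
    exact add_mem (Submodule.smul_mem _ _ hb) (Submodule.smul_mem _ _ ha)

/-- If `P` is generated over `k` by the family `x`, a `P`-algebra `K` is formally unramified over
`P` exactly when the differentials of the `x i` generate `Ω[K⁄k]`. -/
theorem formallyUnramified_iff_span_eq_top {k P K ι : Type*} [CommRing k] [CommRing P]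
    [CommRing K] [Algebra k P] [Algebra P K] [Algebra k K] [IsScalarTower k P K] {x : ι → P}
    (hx : Algebra.adjoin k (Set.range x) = ⊤) :
    Algebra.FormallyUnramified P K ↔
      Submodule.span K (Set.range fun i => D k K (algebraMap P K (x i))) = ⊤ := by
  have hrange : LinearMap.range (mapBaseChange k P K) =
      Submodule.span K (Set.range fun i => D k K (algebraMap P K (x i))) := by
    apply le_antisymm
    · rintro _ ⟨u, rfl⟩
      induction u with
      | zero => rw [map_zero]; exact zero_mem _
      | add u v hu hv => rw [map_add]; exact add_mem hu hv
      | tmul a w =>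
        rw [mapBaseChange_tmul]
        refine Submodule.smul_mem _ _ ?_
        have hw : w ∈ Submodule.span P (Set.range fun i => D k P (x i)) := by
          rw [span_range_D_eq_top_of_adjoin_eq_top hx]; trivial
        induction hw using Submodule.span_induction with
        | mem w hw =>
          obtain ⟨i, rfl⟩ := hw
          exact Submodule.subset_span ⟨i, by simp⟩
        | zero => rw [map_zero]; exact zero_mem _
        | add x y _ _ hx hy => rw [map_add]; exact add_mem hx hy
        | smul a x _ hx =>
          rw [map_smul, ← algebraMap_smul K]
          exact Submodule.smul_mem _ _ hx
    · rw [Submodule.span_le]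
      rintro _ ⟨i, rfl⟩
      exact ⟨1 ⊗ₜ D k P (x i), by simp⟩
  rw [Algebra.formallyUnramified_iff, ← hrange,
    (exact_mapBaseChange_map k P K).linearMap_ker_eq.symm, LinearMap.ker_eq_top]
  constructor
  · intro h
    ext
    exact Subsingleton.elim _ _
  · intro h
    refine subsingleton_of_forall_eq 0 fun u => ?_
    obtain ⟨v, rfl⟩ := map_surjective k P K u
    rw [h]; rfl

end KaehlerDifferential

instance Ideal.ResidueField.formallyUnramified {B : Type*} [CommRing B] (q : Ideal B) [q.IsPrime] :
    Algebra.FormallyUnramified B q.ResidueField := by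
  have : Algebra.FormallyUnramified B (Localization.AtPrime q) :=
    .of_isLocalization q.primeCompl
  have : Algebra.FormallyUnramified (Localization.AtPrime q) q.ResidueField :=
    .of_surjective (Algebra.ofId (Localization.AtPrime q) _) IsLocalRing.residue_surjective
  exact .comp B (Localization.AtPrime q) q.ResidueField

open KaehlerDifferential IntermediateField.algebraAdjoinAdjoin in
/-- The differentials of a finitely generated extension of a perfect field have dimension at most
the transcendence degree. -/
theorem finrank_kaehlerDifferential_le_of_trdeg_le (k K : Type*) [Field k] [PerfectField k]
    [Field K] [Algebra k K] [Algebra.EssFiniteType k K] {d : ℕ} (hd : Algebra.trdeg k K ≤ d) :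
    Module.finrank K Ω[K⁄k] ≤ d := by
  obtain ⟨s, hs, hsep⟩ := exists_isTranscendenceBasis_and_isSeparable_of_perfectField k K
  have hcard : s.card ≤ d := by
    rw [← hs.cardinalMk_eq_trdeg] at hd
    simpa using hd
  have h1 : Algebra.FormallyUnramified (IntermediateField.adjoin k (s : Set K)) K :=
    .of_isSeparable _ _
  have h2 : Algebra.FormallyUnramified (Algebra.adjoin k (s : Set K))
      (IntermediateField.adjoin k (s : Set K)) :=
    .of_isLocalization (nonZeroDivisors (Algebra.adjoin k (s : Set K)))
  have : Algebra.FormallyUnramified (Algebra.adjoin k (s : Set K)) K :=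
    .comp _ (IntermediateField.adjoin k (s : Set K)) _
  let x : s → Algebra.adjoin k (s : Set K) := fun i => ⟨i, Algebra.subset_adjoin i.2⟩
  have hx : Set.range x = Subtype.val ⁻¹' (s : Set K) := by
    ext a
    constructor
    · rintro ⟨i, rfl⟩
      exact i.2
    · intro ha
      exact ⟨⟨a.1, ha⟩, rfl⟩
  have hspan := (formallyUnramified_iff_span_eq_top (k := k) (K := K) (x := x)
    (by rw [hx]; exact Algebra.adjoin_adjoin_coe_preimage)).mp this
  rw [← finrank_top, ← hspan]
  refine (finrank_range_le_card _).trans ?_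
  simpa using hcard

theorem Ideal.injective_algebraMap_residueField {P B : Type*} [CommRing P] [CommRing B]
    [Algebra P B] (q : Ideal B) [q.IsPrime]
    (hq : q.comap (algebraMap P B) = ⊥) : Function.Injective (algebraMap P q.ResidueField) := by
  rw [RingHom.injective_iff_ker_eq_bot, IsScalarTower.algebraMap_eq P B q.ResidueField,
    ← RingHom.comap_ker, Ideal.ker_algebraMap_residueField, hq]

section

variable {P B : Type*} [CommRing P] [IsDomain P] [CommRing B] [Algebra P B]

theorem Ideal.isAlgebraic_residueField [Algebra.IsIntegral P B] (q : Ideal B) [q.IsPrime]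
    (hq : q.comap (algebraMap P B) = ⊥) : Algebra.IsAlgebraic P q.ResidueField := by
  have hinj := q.injective_algebraMap_residueField hq
  have : FaithfulSMul P q.ResidueField := (faithfulSMul_iff_algebraMap_injective _ _).mpr hinj
  exact (IsFractionRing.isAlgebraic_iff' P (B ⧸ q) q.ResidueField).mp inferInstance

theorem Ideal.trdeg_residueField_le {k : Type*} [Field k] [Algebra k P] [Algebra k B]
    [IsScalarTower k P B] [Algebra.IsIntegral P B] (q : Ideal B) [q.IsPrime]
    (hq : q.comap (algebraMap P B) = ⊥) {d : ℕ} {x : Fin d → P}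
    (hx : Algebra.adjoin k (Set.range x) = ⊤) : Algebra.trdeg k q.ResidueField ≤ d := by
  have hinj := q.injective_algebraMap_residueField hq
  have halg := q.isAlgebraic_residueField hq
  let s : Set q.ResidueField := Set.range fun i => algebraMap P q.ResidueField (x i)
  have hs : ∀ p : P, algebraMap P q.ResidueField p ∈ Algebra.adjoin k s := by
    intro p
    have hp : p ∈ Algebra.adjoin k (Set.range x) := hx ▸ Algebra.mem_top
    have h1 : IsScalarTower.toAlgHom k P q.ResidueField p ∈
        (Algebra.adjoin k (Set.range x)).map (IsScalarTower.toAlgHom k P q.ResidueField) :=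
      ⟨p, hp, rfl⟩
    rwa [AlgHom.map_adjoin, ← Set.range_comp] at h1
  have : Algebra.IsAlgebraic (Algebra.adjoin k s) q.ResidueField := by
    let f : P →+* Algebra.adjoin k s := (algebraMap P q.ResidueField).codRestrict _ hs
    let := f.toAlgebra
    have : IsScalarTower P (Algebra.adjoin k s) q.ResidueField := .of_algebraMap_eq fun _ => rfl
    exact Algebra.IsAlgebraic.extendScalars (R := P) (S := Algebra.adjoin k s)
      fun a b hab => hinj (congrArg Subtype.val hab)
  refine (Algebra.IsAlgebraic.trdeg_le_cardinalMk k s).trans ?_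
  simpa using Cardinal.mk_range_le_lift (f := fun i => algebraMap P q.ResidueField (x i))

/-- If the residue field at a prime over the generic point of `P` is unramified over `P`, it is
a finite separable extension of the fraction field of `P`, hence formally étale over `P`. -/
theorem Ideal.formallyEtale_residueField [Algebra.FiniteType P B] (q : Ideal B) [q.IsPrime]
    (hq : q.comap (algebraMap P B) = ⊥) [Algebra.FormallyUnramified P q.ResidueField] :
    Algebra.FormallyEtale P q.ResidueField := by
  have hinj := q.injective_algebraMap_residueField hq
  have : FaithfulSMul P q.ResidueField := (faithfulSMul_iff_algebraMap_injective _ _).mpr hinj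
  let := FractionRing.liftAlgebra P q.ResidueField
  have : Algebra.EssFiniteType P q.ResidueField := .comp P B q.ResidueField
  have : Algebra.EssFiniteType (FractionRing P) q.ResidueField :=
    .of_comp P (FractionRing P) q.ResidueField
  have : Algebra.FormallyUnramified (FractionRing P) q.ResidueField :=
    .of_restrictScalars P _ _
  have : Algebra.FormallyEtale (FractionRing P) q.ResidueField :=
    .of_formallyUnramified_of_field _ _
  have : Algebra.FormallyEtale P (FractionRing P) := .of_isLocalization (nonZeroDivisors P)
  exact .comp P (FractionRing P) q.ResidueField

end

open KaehlerDifferential in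
/-- If the residue field at `q` is formally étale over the base, the cotangent space at `q` is the
fibre of the differentials. -/
theorem embeddingDimension_eq_finrank {P B : Type*} [CommRing P] [CommRing B] [Algebra P B]
    (q : Ideal B) [q.IsPrime] [Algebra.FormallyEtale P q.ResidueField] :
    embeddingDimension (Localization.AtPrime q) =
      Module.finrank q.ResidueField (q.ResidueField ⊗[B] Ω[B⁄P]) := by
  let S := Localization.AtPrime q
  let K := q.ResidueField
  have hsurj : Function.Surjective (algebraMap S K) := IsLocalRing.residue_surjective
  have hker : RingHom.ker (algebraMap S K) = IsLocalRing.maximalIdeal S :=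
    IsLocalRing.ker_residue
  have : Algebra.FormallyEtale B S := .of_isLocalization q.primeCompl
  have hinj : Function.Injective (kerCotangentToTensor P S K) := by
    let f := (IsScalarTower.toAlgHom P S K).kerSquareLift
    have hf : Function.Surjective f := fun x => by
      obtain ⟨x, rfl⟩ := hsurj x
      exact ⟨Ideal.Quotient.mk _ x, rfl⟩
    have hf2 : IsNilpotent (RingHom.ker f.toRingHom) := by
      refine ⟨2, ?_⟩
      have := (IsScalarTower.toAlgHom P S K).ker_kerSquareLift
      rw [show RingHom.ker f.toRingHom = _ from this, Ideal.cotangentIdeal_square]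
      rfl
    let g := Algebra.FormallySmooth.liftOfSurjective (AlgHom.id P K) f hf hf2
    have hg : f.comp g = AlgHom.id P K := Algebra.FormallySmooth.comp_liftOfSurjective _ _ _ _
    obtain ⟨l, hl⟩ := (retractionKerCotangentToTensorEquivSection (R := P) hsurj).symm ⟨g, hg⟩
    exact Function.LeftInverse.injective (g := l) fun x => LinearMap.congr_fun hl x
  have hsurj' : Function.Surjective (kerCotangentToTensor P S K) := by
    have hex := exact_kerCotangentToTensor_mapBaseChange P S K hsurj
    have : Subsingleton Ω[K⁄P] := (Algebra.formallyUnramified_iff P K).mp inferInstance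
    exact fun x => (hex x).mp (Subsingleton.elim _ _)
  let e₁ : (RingHom.ker (algebraMap S K)).Cotangent ≃ₗ[S] K ⊗[S] Ω[S⁄P] :=
    LinearEquiv.ofBijective _ ⟨hinj, hsurj'⟩
  let e₂ : IsLocalRing.CotangentSpace S ≃ₗ[S] K ⊗[S] Ω[S⁄P] :=
    (Ideal.Cotangent.equivOfEq _ _ hker.symm).trans e₁
  let e₃ : IsLocalRing.CotangentSpace S ≃ₗ[K] K ⊗[S] Ω[S⁄P] :=
    e₂.extendScalarsOfSurjective hsurj
  let e₄ : K ⊗[S] (S ⊗[B] Ω[B⁄P]) ≃ₗ[K] K ⊗[S] Ω[S⁄P] :=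
    AlgebraTensorModule.congr (.refl K K) (tensorKaehlerEquivOfFormallyEtale P B S)
  let e₅ : K ⊗[S] (S ⊗[B] Ω[B⁄P]) ≃ₗ[K] K ⊗[B] Ω[B⁄P] :=
    AlgebraTensorModule.cancelBaseChange B S K K Ω[B⁄P]
  exact (e₃.trans (e₄.symm.trans e₅)).finrank_eq

/-! ### Isomorphism at a generic prime -/

open KaehlerDifferential in
/-- A finite unramified algebra over a field with only one point in an algebraic closure is
trivial: the kernel of multiplication on `E ⊗ E` is generated by an idempotent, and any point of
its support would give two different points of `E`. -/
theorem Algebra.FormallyUnramified.surjective_algebraMap_of_subsingleton_algHom {K E : Type*}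
    [Field K] [CommRing E] [Algebra K E] [Module.Finite K E] [Algebra.FormallyUnramified K E]
    [Subsingleton (E →ₐ[K] AlgebraicClosure K)] : Function.Surjective (algebraMap K E) := by
  rw [← Algebra.isEpi_iff_surjective_algebraMap_of_finite,
    Algebra.isEpi_iff_forall_one_tmul_eq]
  have hidem : IsIdempotentElem (KaehlerDifferential.ideal K E) :=
    (Ideal.cotangent_subsingleton_iff _).mp
      ((Algebra.formallyUnramified_iff K E).mp inferInstance)
  obtain ⟨e, he, hJ⟩ := (Ideal.isIdempotentElem_iff_of_fg _ (KaehlerDifferential.ideal_fg K E)).mp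
    hidem
  suffices h0 : e = 0 by
    intro a
    have := KaehlerDifferential.one_smul_sub_smul_one_mem_ideal K a
    rw [hJ, h0] at this
    simpa [sub_eq_zero] using this
  by_contra hne
  have htop : Ideal.span {1 - e} ≠ ⊤ := by
    rw [Ne, Ideal.span_singleton_eq_top]
    intro hu
    exact hne (hu.mul_left_eq_zero.mp (by rw [mul_sub, mul_one, he.eq, sub_self]))
  obtain ⟨m, hm, hle⟩ := Ideal.exists_le_maximal _ htop
  let := Ideal.Quotient.field m
  let ψ : E ⊗[K] E →ₐ[K] AlgebraicClosure K :=
    (IsAlgClosed.lift (R := K) (S := (E ⊗[K] E) ⧸ m) (M := AlgebraicClosure K)).comp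
      (Ideal.Quotient.mkₐ K m)
  have h1 : ψ (1 - e) = 0 := by
    have : Ideal.Quotient.mk m (1 - e) = 0 :=
      Ideal.Quotient.eq_zero_iff_mem.mpr (hle (Ideal.mem_span_singleton_self _))
    change IsAlgClosed.lift (Ideal.Quotient.mk m (1 - e)) = _
    rw [this, map_zero]
  have h2 : KaehlerDifferential.ideal K E ≤ RingHom.ker ψ := by
    rw [← KaehlerDifferential.span_range_eq_ideal, Ideal.span_le]
    rintro _ ⟨a, rfl⟩
    have := AlgHom.congr_fun (Subsingleton.elim (ψ.comp Algebra.TensorProduct.includeLeft)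
      (ψ.comp Algebra.TensorProduct.includeRight)) a
    simp only [AlgHom.comp_apply, Algebra.TensorProduct.includeLeft_apply,
      Algebra.TensorProduct.includeRight_apply] at this
    simp [RingHom.mem_ker, this]
  have h3 : ψ e = 0 := h2 (hJ ▸ Ideal.mem_span_singleton_self e)
  rw [map_sub, h3, map_one, sub_zero] at h1
  exact one_ne_zero h1

section

variable {P A B : Type*} [CommRing P] [CommRing A] [CommRing B] [Algebra P A] [Algebra A B]
  [Algebra P B] [IsScalarTower P A B]

attribute [local instance] Algebra.TensorProduct.rightAlgebra in
open KaehlerDifferential in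
/-- The differentials of the `t i` generate `Ω[B⁄P]` near the fibre over `p`, and they vanish on the
fibre because `t i` becomes a scalar there. -/
theorem formallyUnramified_residueField_tensorProduct [Module.Finite A B] (p : Ideal A) [p.IsPrime]
    {ι : Type*} (t : ι → A)
    (ht : ∀ (q : Ideal B) [q.IsPrime], q.comap (algebraMap A B) = p → ∃ h ∉ q, ∀ x : Ω[B⁄P],
      h • x ∈ Submodule.span B (Set.range fun i => D P B (algebraMap A B (t i)))) :
    Algebra.FormallyUnramified p.ResidueField (p.ResidueField ⊗[A] B) := by
  let K := p.ResidueField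
  let E := K ⊗[A] B
  rw [Algebra.formallyUnramified_iff, ← Module.support_eq_empty_iff (R := E),
    Set.eq_empty_iff_forall_notMem]
  intro Q hQ
  let q : Ideal B := Q.asIdeal.comap (algebraMap B E)
  have hAE (a : A) : algebraMap B E (algebraMap A B a) = algebraMap K E (algebraMap A K a) := by
    change (1 : K) ⊗ₜ[A] algebraMap A B a = algebraMap A K a ⊗ₜ[A] (1 : B)
    rw [Algebra.algebraMap_eq_smul_one, Algebra.algebraMap_eq_smul_one, smul_tmul]
  have hq : q.comap (algebraMap A B) = p := by
    ext a
    rw [Ideal.mem_comap, Ideal.mem_comap, hAE, ← Ideal.algebraMap_residueField_eq_zero (I := p)]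
    constructor
    · intro h
      by_contra hne
      exact Q.2.ne_top (Ideal.eq_top_of_isUnit_mem _ h ((isUnit_iff_ne_zero.mpr hne).map _))
    · intro h
      rw [h, map_zero]
      exact zero_mem _
  obtain ⟨h, hhq, hh⟩ := ht q hq
  have : IsScalarTower P B E := .of_algebraMap_eq fun x => by
    rw [IsScalarTower.algebraMap_apply P A B, hAE, ← IsScalarTower.algebraMap_apply P A K]
    rfl
  let φ : Ω[B⁄P] →ₗ[B] Ω[E⁄K] := KaehlerDifferential.map P K B E
  have hφ (b : B) : φ (D P B b) = D K E (algebraMap B E b) := KaehlerDifferential.map_D _ _ _ _ b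
  have hspan : ∀ x ∈ Submodule.span B (Set.range fun i => D P B (algebraMap A B (t i))),
      φ x = 0 := by
    intro x hx
    induction hx using Submodule.span_induction with
    | mem x hx =>
      obtain ⟨i, rfl⟩ := hx
      rw [hφ, hAE, Derivation.map_algebraMap]
    | zero => rw [map_zero]
    | add x y _ _ hx hy => rw [map_add, hx, hy, add_zero]
    | smul a x _ hx => rw [map_smul, hx, smul_zero]
  rw [Module.mem_support_iff_of_finite] at hQ
  refine hhq (hQ ?_ : algebraMap B E h ∈ Q.asIdeal)
  rw [Module.mem_annihilator]
  intro x
  have hx : x ∈ Submodule.span E (Set.range fun b : B => D K E (algebraMap B E b)) := by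
    rw [span_range_D_eq_top_of_adjoin_eq_top]
    · trivial
    · rw [eq_top_iff]
      rintro u -
      induction u using TensorProduct.induction_on with
      | zero => exact zero_mem _
      | add u v hu hv => exact add_mem hu hv
      | tmul a b =>
        have : a ⊗ₜ[A] b = a • algebraMap B E b := by
          change _ = a • ((1 : K) ⊗ₜ[A] b)
          rw [smul_tmul', smul_eq_mul, mul_one]
        rw [this]
        exact Subalgebra.smul_mem _ (Algebra.subset_adjoin (Set.mem_range_self b)) a
  induction hx using Submodule.span_induction with
  | mem x hx =>
    obtain ⟨b, rfl⟩ := hx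
    beta_reduce
    rw [← hφ, algebraMap_smul, ← map_smul]
    exact hspan _ (hh _)
  | zero => rw [smul_zero]
  | add x y _ _ hx hy => rw [smul_add, hx, hy, add_zero]
  | smul a x _ hx => rw [smul_comm, hx, smul_zero]

/-- If `A → B` is unramified over `p`, as witnessed by elements of `A` whose differentials generate
`Ω[B⁄P]` near the primes over `p`, and there is only one geometric point over `p`, then `A → B`
is surjective at `p`. -/
theorem notMem_support_quotient_of_unramified [Module.Finite A B] (p : PrimeSpectrum A)
    {ι : Type*} (t : ι → A)
    (ht : ∀ (q : Ideal B) [q.IsPrime], q.comap (algebraMap A B) = p.asIdeal →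
      ∃ h ∉ q, ∀ x : Ω[B⁄P], h • x ∈ Submodule.span B
        (Set.range fun i => KaehlerDifferential.D P B (algebraMap A B (t i))))
    [Subsingleton (B →ₐ[A] AlgebraicClosure p.asIdeal.ResidueField)] :
    p ∉ Module.support A (B ⧸ LinearMap.range (Algebra.linearMap A B)) := by
  let K := p.asIdeal.ResidueField
  have := formallyUnramified_residueField_tensorProduct p.asIdeal t ht
  have : Subsingleton (K ⊗[A] B →ₐ[K] AlgebraicClosure K) := by
    refine ⟨fun σ τ => Algebra.TensorProduct.ext (by ext) ?_⟩
    exact Subsingleton.elim _ _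
  have hsurj := Algebra.FormallyUnramified.surjective_algebraMap_of_subsingleton_algHom
    (K := K) (E := K ⊗[A] B)
  rw [Module.mem_support_iff_nontrivial_residueField_tensorProduct,
    not_nontrivial_iff_subsingleton]
  refine subsingleton_of_forall_eq 0 fun x => ?_
  obtain ⟨x, rfl⟩ := LinearMap.lTensor_surjective K
    (LinearMap.range (Algebra.linearMap A B)).mkQ_surjective x
  obtain ⟨a, rfl⟩ := hsurj x
  rw [Algebra.TensorProduct.algebraMap_apply, LinearMap.lTensor_tmul, Submodule.mkQ_apply,
    (Submodule.Quotient.mk_eq_zero (LinearMap.range (Algebra.linearMap A B))).mpr ⟨1, by simp⟩,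
    tmul_zero]

end

/-- Points over `P` with values in an algebraic closure separate geometric points at every prime
over the generic point of `P`. -/
theorem subsingleton_algHom_algebraicClosure_residueField {P A B L : Type*} [CommRing P]
    [IsDomain P] [CommRing A] [CommRing B] [Algebra P A] [Algebra A B]
    [Algebra P B] [IsScalarTower P A B] [Algebra.IsIntegral P A] [Field L] [IsAlgClosed L]
    [Algebra P L] [FaithfulSMul P L] (p : Ideal A) [p.IsPrime]
    (hp : p.comap (algebraMap P A) = ⊥) (w : A)
    (hw : ∀ σ τ : B →ₐ[P] L, σ (algebraMap A B w) = τ (algebraMap A B w) → σ = τ) :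
    Subsingleton (B →ₐ[A] AlgebraicClosure p.ResidueField) := by
  have halg := p.isAlgebraic_residueField hp
  have hinj := p.injective_algebraMap_residueField hp
  let K' := AlgebraicClosure p.ResidueField
  have : Algebra.IsAlgebraic P K' := .trans P p.ResidueField K'
  have : FaithfulSMul P K' := (faithfulSMul_iff_algebraMap_injective P K').mpr (by
    rw [IsScalarTower.algebraMap_eq P p.ResidueField K']
    exact (algebraMap p.ResidueField K').injective.comp hinj)
  -- the residue field at `p` is algebraic over `P`, so its algebraic closure embeds in `L`
  let j : K' →ₐ[P] L := IsAlgClosed.lift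
  refine ⟨fun σ τ => AlgHom.ext fun b => j.injective ?_⟩
  refine AlgHom.congr_fun (hw (j.comp (σ.restrictScalars P)) (j.comp (τ.restrictScalars P)) ?_) b
  simp

/-- A homomorphism is determined by its values on a finite generating set, which are roots of fixed
monic polynomials. -/
theorem finite_algHom_of_finite {P B L : Type*} [CommRing P] [CommRing B] [Algebra P B]
    [Module.Finite P B] [Field L] [Algebra P L] : Finite (B →ₐ[P] L) := by
  classical
  obtain ⟨S, hS⟩ := Module.Finite.fg_top (R := P) (M := B)
  choose f hf hf0 using fun b : B => Algebra.IsIntegral.isIntegral (R := P) b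
  let F : (B →ₐ[P] L) → ∀ b : S, {a : L // a ∈ (f b).aroots L} := fun σ b =>
    ⟨σ b, (Polynomial.mem_aroots'.mpr ⟨((hf b).map (algebraMap P L)).ne_zero, by
      rw [Polynomial.aeval_algHom_apply, Polynomial.aeval_def, hf0, map_zero]⟩)⟩
  refine Finite.of_injective F fun σ τ h => ?_
  refine AlgHom.toLinearMap_injective (LinearMap.ext_on hS fun b hb => ?_)
  exact congrArg Subtype.val (congrFun h ⟨b, hb⟩)

/-- A general linear combination of generators separates points. -/
theorem forGeneral_separates {k P B L : Type*} [Field k] [Infinite k] [CommRing P] [CommRing B]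
    [Algebra k P] [Algebra k B] [Algebra P B] [IsScalarTower k P B] [Field L] [Algebra P L]
    [Algebra k L] [IsScalarTower k P L] [Module.Finite P B] {m n : ℕ} {y : Fin n → B}
    (hy : Algebra.adjoin k (Set.range y) = ⊤) (i : Fin m) :
    ForGeneral fun c : Fin m × Fin n → k => ∀ σ τ : B →ₐ[P] L,
      σ (linearCombinations y c i) = τ (linearCombinations y c i) → σ = τ := by
  classical
  have := finite_algHom_of_finite (P := P) (B := B) (L := L)
  refine ForGeneral.forall_finite fun σ => ForGeneral.forall_finite fun τ => ?_
  by_cases hστ : σ = τ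
  · exact ForGeneral.of_forall fun _ _ => hστ
  obtain ⟨j, hj⟩ : ∃ j, σ (y j) ≠ τ (y j) := by
    by_contra! h
    refine hστ (AlgHom.restrictScalars_injective k (AlgHom.ext_of_adjoin_eq_top hy ?_))
    rintro _ ⟨j, rfl⟩
    exact h j
  let g : MvPolynomial (Fin m × Fin n) L :=
    ∑ j, MvPolynomial.X (i, j) * MvPolynomial.C (σ (y j) - τ (y j))
  have hg (c : Fin m × Fin n → k) : MvPolynomial.eval (fun p => algebraMap k L (c p)) g =
      σ (linearCombinations y c i) - τ (linearCombinations y c i) := by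
    have hk (σ : B →ₐ[P] L) (a : k) (b : B) : σ (a • b) = a • σ b :=
      map_smul (σ.restrictScalars k) a b
    simp only [g, linearCombinations, map_sum, map_mul, MvPolynomial.eval_X, MvPolynomial.eval_C,
      hk, ← Finset.sum_sub_distrib]
    simp only [Algebra.smul_def, mul_sub]
  refine (ForGeneral.of_eval_ne_zero g (Pi.single (i, j) 1) ?_).mono fun c hc h => ?_
  · rw [hg]
    simp only [linearCombinations, map_sum]
    rw [Finset.sum_eq_single j, Finset.sum_eq_single j]
    · simpa [sub_eq_zero] using hj
    all_goals simp +contextual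
  · rw [hg, h, sub_self] at hc
    exact absurd rfl hc

/-! ### Openness of generic isomorphism -/

/-- Nakayama's lemma at a prime, in terms of elements. -/
theorem Submodule.FG.exists_notMem_forall_smul_eq_zero {A M : Type*} [CommRing A] [AddCommGroup M]
    [Module A M] {N : Submodule A M} (hN : N.FG) (p : Ideal A) [p.IsPrime]
    (h : ∀ x ∈ N, ∃ s ∉ p, s • x ∈ p • N) : ∃ s ∉ p, ∀ x ∈ N, s • x = 0 := by
  have : Module.Finite A N := Module.Finite.iff_fg.mpr hN
  have hsub : Subsingleton (p.ResidueField ⊗[A] N) := by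
    have hp (x : N) (hx : (x : M) ∈ p • N) : (1 : p.ResidueField) ⊗ₜ[A] x = 0 := by
      have hx' : x ∈ p • (⊤ : Submodule A N) := by
        have : (p • (⊤ : Submodule A N)).map N.subtype = p • N := by
          rw [Submodule.map_smul'', Submodule.map_top, Submodule.range_subtype]
        rw [← this] at hx
        obtain ⟨x', hx', hxx'⟩ := hx
        rwa [← Subtype.ext hxx']
      refine Submodule.smul_induction_on hx' (fun a ha y _ => ?_) fun y z hy hz => ?_
      · rw [tmul_smul, ← algebraMap_smul p.ResidueField,
          Ideal.algebraMap_residueField_eq_zero.mpr ha, zero_smul]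
      · rw [tmul_add, hy, hz, add_zero]
    refine subsingleton_of_forall_eq 0 fun x => ?_
    induction x with
    | zero => rfl
    | add x y hx hy => rw [hx, hy, add_zero]
    | tmul a x =>
      obtain ⟨s, hs, hsx⟩ := h x x.2
      have hs0 : algebraMap A p.ResidueField s ≠ 0 := fun h0 =>
        hs (Ideal.algebraMap_residueField_eq_zero.mp h0)
      have h1 := hp (s • x) hsx
      rw [tmul_smul, ← algebraMap_smul p.ResidueField, smul_eq_zero_iff_right hs0] at h1
      rw [← mul_one a, ← smul_eq_mul, ← smul_tmul', h1, smul_zero]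
  obtain ⟨s, hs, hsN⟩ := (Ideal.exists_notMem_forall_smul_eq_zero_iff p).mpr hsub
  exact ⟨s, hs, fun x hx => congrArg Subtype.val (hsN ⟨x, hx⟩)⟩

section

open MvPolynomial

variable {k B : Type*} [Field k] [CommRing B] [Algebra k B] {m n : ℕ}

/-- The subalgebra of `B[c]`, where `c` is an `m × n` matrix of indeterminates, generated over
`k[c]` by the `m` linear combinations of `y` with coefficient matrix `c`. Its specializations are
the algebras `linearCombinationSubalgebra y c`. -/
noncomputable def genericSubalgebra (k : Type*) {B : Type*} [Field k] [CommRing B] [Algebra k B]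
    {n : ℕ} (y : Fin n → B) (m : ℕ) : Subalgebra k (MvPolynomial (Fin m × Fin n) B) :=
  Algebra.adjoin k (Set.range X ∪ Set.range fun i : Fin m => ∑ j, X (i, j) * C (y j))

/-- Specialization `B[c] → B` of the indeterminates to a rational point `c`. -/
noncomputable def specialize {σ : Type*} (c : σ → k) : MvPolynomial σ B →ₐ[k] B :=
  (aeval fun i => algebraMap k B (c i)).restrictScalars k

theorem specialize_C {σ : Type*} (c : σ → k) (b : B) : specialize c (C b) = b := by
  simp [specialize]

theorem specialize_X {σ : Type*} (c : σ → k) (i : σ) :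
    specialize (B := B) c (X i) = algebraMap k B (c i) := by
  simp [specialize]

theorem specialize_map {σ : Type*} (c : σ → k) (f : MvPolynomial σ k) :
    specialize c (map (algebraMap k B) f) = algebraMap k B (eval c f) := by
  induction f using MvPolynomial.induction_on with
  | C a => simp [specialize]
  | add f g hf hg => simp only [map_add, hf, hg]
  | mul_X f i hf => simp only [map_mul, hf, map_X, specialize_X, eval_X]

theorem X_mem_genericSubalgebra (y : Fin n → B) (τ : Fin m × Fin n) :
    X τ ∈ genericSubalgebra k y m :=
  Algebra.subset_adjoin (Or.inl ⟨τ, rfl⟩)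

theorem sum_X_mul_C_mem_genericSubalgebra (y : Fin n → B) (i : Fin m) :
    ∑ j, X (i, j) * C (y j) ∈ genericSubalgebra k y m :=
  Algebra.subset_adjoin (Or.inr ⟨i, rfl⟩)

theorem map_mem_genericSubalgebra (y : Fin n → B) (f : MvPolynomial (Fin m × Fin n) k) :
    map (algebraMap k B) f ∈ genericSubalgebra k y m := by
  induction f using MvPolynomial.induction_on with
  | C a =>
    rw [map_C]
    exact (genericSubalgebra k y m).algebraMap_mem a
  | add f g hf hg => rw [map_add]; exact add_mem hf hg
  | mul_X f i hf => rw [map_mul, map_X]; exact mul_mem hf (X_mem_genericSubalgebra y i)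

theorem specialize_sum_X_mul_C (y : Fin n → B) (c : Fin m × Fin n → k) (i : Fin m) :
    specialize c (∑ j, X (i, j) * C (y j)) = linearCombinations y c i := by
  simp only [map_sum, map_mul, specialize_C, specialize_X, linearCombinations, Algebra.smul_def]

theorem map_specialize_genericSubalgebra (y : Fin n → B) (c : Fin m × Fin n → k) :
    (genericSubalgebra k y m).map (specialize c) = linearCombinationSubalgebra y c := by
  rw [genericSubalgebra, AlgHom.map_adjoin]
  apply le_antisymm
  · rw [Algebra.adjoin_le_iff]
    rintro _ ⟨_, ⟨τ, rfl⟩ | ⟨i, rfl⟩, rfl⟩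
    · rw [specialize_X]
      exact (linearCombinationSubalgebra y c).algebraMap_mem _
    · beta_reduce
      rw [specialize_sum_X_mul_C]
      exact linearCombinations_mem_adjoin y c i
  · refine Algebra.adjoin_mono ?_
    rintro _ ⟨i, rfl⟩
    exact ⟨_, Or.inr ⟨i, rfl⟩, specialize_sum_X_mul_C y c i⟩

/-- The submodule of `B[c]` over the generic subalgebra generated by `W ^ D`, where `W` is spanned
by `1` and `y`. -/
noncomputable def genericSpan (k : Type*) {B : Type*} [Field k] [CommRing B] [Algebra k B] {n : ℕ}
    (y : Fin n → B) (m D : ℕ) :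
    Submodule (genericSubalgebra k y m) (MvPolynomial (Fin m × Fin n) B) :=
  Submodule.span _ (C '' (unitalSpan k y ^ D : Submodule k B))

theorem genericSpan_fg (y : Fin n → B) (m D : ℕ) : (genericSpan k y m D).FG := by
  obtain ⟨S, hS⟩ := (unitalSpan_fg (k := k) y).pow D
  classical
  refine ⟨S.image C, le_antisymm (Submodule.span_mono ?_) (Submodule.span_le.mpr ?_)⟩
  · rw [Finset.coe_image, ← hS]
    exact Set.image_mono Submodule.subset_span
  · rintro _ ⟨b, hb, rfl⟩
    rw [SetLike.mem_coe] at hb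
    rw [← hS] at hb
    induction hb using Submodule.span_induction with
    | mem b hb => exact Submodule.subset_span (Finset.mem_coe.mpr (Finset.mem_image_of_mem C hb))
    | zero => simp
    | add b b' _ _ hb hb' => rw [C_add]; exact add_mem hb hb'
    | smul a b _ hb =>
      rw [Algebra.smul_def, C_mul]
      exact Submodule.smul_mem _ (algebraMap k (genericSubalgebra k y m) a) hb

theorem mul_mem_genericSpan {y : Fin n → B} {D : ℕ} {a x : MvPolynomial (Fin m × Fin n) B}
    (ha : a ∈ genericSubalgebra k y m) (hx : x ∈ genericSpan k y m D) :
    a * x ∈ genericSpan k y m D :=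
  (genericSpan k y m D).smul_mem ⟨a, ha⟩ hx

theorem C_mem_genericSpan {y : Fin n → B} {D : ℕ} {w : B} (hw : w ∈ unitalSpan k y ^ D) :
    C w ∈ genericSpan k y m D :=
  Submodule.subset_span ⟨w, hw, rfl⟩

/-- If the reduction property holds at `c₀`, it holds generically after inverting a polynomial
that does not vanish at `c₀`. -/
theorem exists_map_mul_C_mem_genericSpan {y : Fin n → B} {D : ℕ} {c₀ : Fin m × Fin n → k}
    (hD : unitalSpan k y ^ (D + 1) ≤
      unitalSpan k (linearCombinations y c₀) * unitalSpan k y ^ D) :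
    ∃ f : MvPolynomial (Fin m × Fin n) k, eval c₀ f ≠ 0 ∧
      ∀ w ∈ unitalSpan k y ^ (D + 1), map (algebraMap k B) f * C w ∈ genericSpan k y m D := by
  obtain ⟨r, b, e, hdet⟩ := exists_basis_of_span_affine_eq_top _ _ c₀
    ((span_reduction_eq_top_iff y D c₀).mpr hD)
  set M : Matrix (Fin r) (Fin r) (MvPolynomial (Fin m × Fin n) k) := Matrix.of fun i j =>
    C (b.repr (reductionConst k y m D (e i)) j) +
      ∑ τ, X τ * C (b.repr (reductionLin k y m D (e i) τ) j) with hM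
  let φ := map (σ := Fin m × Fin n) (algebraMap k B)
  have hrepr (v : (unitalSpan k y ^ (D + 1) : Submodule k B)) :
      ∑ j, algebraMap k B (b.repr v j) * (b j : B) = v := by
    have := congrArg (Submodule.subtype _) (b.sum_repr v)
    simpa only [map_sum, map_smul, Submodule.subtype_apply, Algebra.smul_def] using this
  -- the rows of `M` are the coordinates of elements of the span, whence `hb` by the adjugate of `M`
  have hg (i : Fin r) : ∑ j, φ (M i j) * C (b j : B) ∈ genericSpan k y m D := by
    have : ∑ j, φ (M i j) * C (b j : B) = C (reductionConst k y m D (e i) : B) +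
        ∑ τ, X τ * C (reductionLin k y m D (e i) τ : B) := by
      have h0 := (hrepr (reductionConst k y m D (e i))).symm
      have h1 (τ) := (hrepr (reductionLin k y m D (e i) τ)).symm
      rw [h0]
      simp only [h1, hM, φ, Matrix.of_apply, map_add, map_sum, map_mul, map_C, map_X, add_mul,
        Finset.sum_add_distrib, Finset.sum_mul, Finset.mul_sum]
      rw [Finset.sum_comm]
      simp only [mul_assoc]
    rw [this]
    rcases e i with ⟨w, _ | i'⟩
    · simpa [reductionConst, reductionLin] using C_mem_genericSpan w.2
    · have h2 : ∑ τ, X τ * C (reductionLin k y m D (w, some i') τ : B) =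
          (∑ j, X (i', j) * C (y j)) * C (w : B) := by
        simp only [coe_reductionLin_some]
        rw [Fintype.sum_prod_type, Finset.sum_eq_single i']
        · simp [Finset.sum_mul, mul_assoc]
        · intro a _ ha
          simp [ha]
        · simp
      rw [h2]
      simpa [reductionConst] using mul_mem_genericSpan (sum_X_mul_C_mem_genericSubalgebra y i')
        (C_mem_genericSpan w.2)
  refine ⟨M.det, hdet, fun w hw => ?_⟩
  have hb (j : Fin r) : φ M.det * C (b j : B) ∈ genericSpan k y m D := by
    have : φ M.det * C (b j : B) = ∑ i, φ (M.adjugate j i) * ∑ l, φ (M i l) * C (b l : B) := by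
      simp only [Finset.mul_sum, ← mul_assoc]
      rw [Finset.sum_comm]
      simp only [← Finset.sum_mul, ← map_mul, ← map_sum]
      have h (l : Fin r) : ∑ i, M.adjugate j i * M i l = if j = l then M.det else 0 := by
        rw [← Matrix.mul_apply, Matrix.adjugate_mul, Matrix.smul_apply, Matrix.one_apply,
          smul_eq_mul, mul_ite, mul_one, mul_zero]
      simp [h, apply_ite φ, ite_mul]
    rw [this]
    exact sum_mem fun i _ => mul_mem_genericSpan (map_mem_genericSubalgebra y _) (hg i)
  have hw' := hrepr ⟨w, hw⟩
  change _ = w at hw'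
  rw [← hw', map_sum, Finset.mul_sum]
  refine sum_mem fun j _ => ?_
  rw [map_mul, mul_left_comm]
  exact mul_mem_genericSpan ((genericSubalgebra k y m).algebraMap_mem _) (hb j)

/-- After inverting `f`, the powers of `W` of exponent at least `D` all generate the same module
over the generic subalgebra, so the finitely generated module `genericSpan` becomes all of `B[c]`.
-/
theorem exists_pow_mul_mem_genericSpan {y : Fin n → B}
    (hy : Algebra.adjoin k (Set.range y) = ⊤) {D : ℕ} {f : MvPolynomial (Fin m × Fin n) k}
    (hf : ∀ w ∈ unitalSpan k y ^ (D + 1),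
      map (algebraMap k B) f * C w ∈ genericSpan k y m D)
    (u : MvPolynomial (Fin m × Fin n) B) :
    ∃ e : ℕ, map (algebraMap k B) f ^ e * u ∈ genericSpan k y m D := by
  set F := map (algebraMap k B) f with hF
  have hFmem (e : ℕ) : F ^ e ∈ genericSubalgebra k y m :=
    pow_mem (map_mem_genericSubalgebra y f) e
  have hmono {e e' : ℕ} (h : e ≤ e') {u} (hu : F ^ e * u ∈ genericSpan k y m D) :
      F ^ e' * u ∈ genericSpan k y m D := by
    rw [← Nat.sub_add_cancel h, pow_add, mul_assoc]
    exact mul_mem_genericSpan (hFmem _) hu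
  have hstep {v : B} (hv : v ∈ unitalSpan k y) {x} (hx : x ∈ genericSpan k y m D) :
      F * (C v * x) ∈ genericSpan k y m D := by
    induction hx using Submodule.span_induction with
    | mem x hx =>
      obtain ⟨w, hw, rfl⟩ := hx
      rw [← C_mul]
      exact hf _ (by rw [pow_succ']; exact Submodule.mul_mem_mul hv hw)
    | zero => simp
    | add x y _ _ hx hy => rw [mul_add, mul_add]; exact add_mem hx hy
    | smul a x _ hx =>
      rw [Subalgebra.smul_def, smul_eq_mul, mul_left_comm (C v), mul_left_comm F]
      exact mul_mem_genericSpan a.2 hx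
  have hpow (e : ℕ) : ∀ w ∈ unitalSpan k y ^ (D + e), F ^ e * C w ∈ genericSpan k y m D := by
    induction e with
    | zero => intro w hw; simpa using C_mem_genericSpan hw
    | succ e ih =>
      intro w hw
      rw [← add_assoc, pow_succ'] at hw
      refine Submodule.mul_induction_on hw (fun v hv w hw => ?_) fun v w hv hw => ?_
      · have := hstep hv (ih w hw)
        have h : F ^ (e + 1) * C (v * w) = F * (C v * (F ^ e * C w)) := by rw [C_mul]; ring
        rwa [h]
      · rw [C_add, mul_add]
        exact add_mem hv hw
  induction u using MvPolynomial.induction_on with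
  | C b =>
    obtain ⟨e, he⟩ := exists_mem_unitalSpan_pow hy b
    exact ⟨e, hpow e b (pow_le_pow_right' (one_le_unitalSpan y) (Nat.le_add_left e D) he)⟩
  | add u v hu hv =>
    obtain ⟨e, he⟩ := hu
    obtain ⟨e', he'⟩ := hv
    exact ⟨max e e', by
      rw [mul_add]
      exact add_mem (hmono (le_max_left _ _) he) (hmono (le_max_right _ _) he')⟩
  | mul_X u i hu =>
    obtain ⟨e, he⟩ := hu
    exact ⟨e, by
      rw [mul_comm u, mul_left_comm]
      exact mul_mem_genericSpan (X_mem_genericSubalgebra y i) he⟩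

/-- If `A_c → B` is an isomorphism at a prime `q` for one point `c = c₀` with the reduction
property, then it is so for general `c`: by Nakayama's lemma over the generic subalgebra, a single
element `s`, whose specialization at `c₀` is not in `q`, maps `B[c]` into the generic subalgebra up
to inverting `f`; its specialization at a general `c` avoids `q` as well. -/
theorem forGeneral_exists_conductor_notMem [Infinite k] {y : Fin n → B}
    (hy : Algebra.adjoin k (Set.range y) = ⊤) {D : ℕ} {c₀ : Fin m × Fin n → k}
    (hD : unitalSpan k y ^ (D + 1) ≤
      unitalSpan k (linearCombinations y c₀) * unitalSpan k y ^ D)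
    (q : Ideal B) [q.IsPrime]
    (hq : ∀ b : B, ∃ h ∈ linearCombinationSubalgebra y c₀, h ∉ q ∧
      h * b ∈ linearCombinationSubalgebra y c₀) :
    ForGeneral fun c : Fin m × Fin n → k => ∃ h ∈ linearCombinationSubalgebra y c, h ∉ q ∧
      ∀ b : B, h * b ∈ linearCombinationSubalgebra y c := by
  obtain ⟨f, hf0, hf⟩ := exists_map_mul_C_mem_genericSpan (m := m) hD
  have hfN := exists_pow_mul_mem_genericSpan hy hf
  let A := genericSubalgebra k y m
  let N := genericSpan k y m D
  let F : A := ⟨map (algebraMap k B) f, map_mem_genericSubalgebra y f⟩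
  let p : Ideal A := q.comap ((specialize c₀).comp A.val)
  have hmemp (a : A) : a ∈ p ↔ specialize c₀ (a : MvPolynomial (Fin m × Fin n) B) ∈ q := Iff.rfl
  have hlift (c : Fin m × Fin n → k) {b : B} (hb : b ∈ linearCombinationSubalgebra y c) :
      ∃ a : A, specialize c (a : MvPolynomial (Fin m × Fin n) B) = b := by
    rw [← map_specialize_genericSubalgebra y c] at hb
    obtain ⟨a, ha, rfl⟩ := hb
    exact ⟨⟨a, ha⟩, rfl⟩
  have hspec (c : Fin m × Fin n → k) {a} (ha : a ∈ A) :
      specialize c a ∈ linearCombinationSubalgebra y c := by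
    rw [← map_specialize_genericSubalgebra y c]
    exact ⟨a, ha, rfl⟩
  have hFp (e : ℕ) : F ^ e ∉ p := by
    intro h
    have h2 : F ∈ p := Ideal.IsPrime.mem_of_pow_mem inferInstance e h
    rw [hmemp, specialize_map] at h2
    exact Ideal.IsPrime.ne_top' (Ideal.eq_top_of_isUnit_mem _ h2
      ((isUnit_iff_ne_zero.mpr hf0).map _))
  -- the ideal `p` contains the differences `X τ - c₀ τ`, so `B[c]` is congruent to its value at
  -- `c₀` modulo `p • N` after inverting `F`
  have hcongr (u : MvPolynomial (Fin m × Fin n) B) :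
      ∃ e : ℕ, F ^ e • (u - C (specialize c₀ u)) ∈ p • N := by
    induction u using MvPolynomial.induction_on with
    | C b => exact ⟨0, by simp [specialize_C]⟩
    | add u v hu hv =>
      obtain ⟨e, he⟩ := hu
      obtain ⟨e', he'⟩ := hv
      refine ⟨e + e', ?_⟩
      have : F ^ (e + e') • (u + v - C (specialize c₀ (u + v))) =
          F ^ e' • F ^ e • (u - C (specialize c₀ u)) +
            F ^ e • F ^ e' • (v - C (specialize c₀ v)) := by
        rw [map_add, C_add]
        simp only [Subalgebra.smul_def, smul_eq_mul, SubmonoidClass.coe_pow]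
        ring
      rw [this]
      exact add_mem (Submodule.smul_mem _ _ he) (Submodule.smul_mem _ _ he')
    | mul_X u τ hu =>
      obtain ⟨e, he⟩ := hu
      obtain ⟨e', he'⟩ := hfN (C (specialize c₀ u))
      let x : A := ⟨X τ, X_mem_genericSubalgebra y τ⟩
      let x' : A := x - algebraMap k A (c₀ τ)
      have hx' : x' ∈ p := by
        rw [hmemp]
        change specialize c₀ (X τ - C (algebraMap k B (c₀ τ))) ∈ q
        rw [map_sub, specialize_X, specialize_C, sub_self]
        exact q.zero_mem
      refine ⟨e + e', ?_⟩
      have : F ^ (e + e') • (u * X τ - C (specialize c₀ (u * X τ))) =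
          F ^ e' • x • F ^ e • (u - C (specialize c₀ u)) +
            F ^ e • x' • ((F : MvPolynomial (Fin m × Fin n) B) ^ e' * C (specialize c₀ u)) := by
        have h1 : (x' : MvPolynomial (Fin m × Fin n) B) = X τ - C (algebraMap k B (c₀ τ)) := rfl
        rw [map_mul, C_mul, specialize_X]
        simp only [Subalgebra.smul_def, smul_eq_mul, SubmonoidClass.coe_pow, h1, x]
        ring
      rw [this]
      exact add_mem (Submodule.smul_mem _ _ (Submodule.smul_mem _ _ he))
        (Submodule.smul_mem _ _ (Submodule.smul_mem_smul hx' he'))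
  have hNak : ∃ s ∉ p, ∀ x ∈ N.map (LinearMap.range (Algebra.linearMap A
      (MvPolynomial (Fin m × Fin n) B))).mkQ, s • x = 0 := by
    refine ((genericSpan_fg y m D).map _).exists_notMem_forall_smul_eq_zero p ?_
    rintro _ ⟨x, hx, rfl⟩
    obtain ⟨h, hA, hhq, hhb⟩ := hq (specialize c₀ x)
    obtain ⟨h, rfl⟩ := hlift c₀ hA
    obtain ⟨a, ha⟩ := hlift c₀ hhb
    obtain ⟨e, he⟩ := hcongr (h • x - a)
    have h0 : specialize c₀ (h • x - (a : MvPolynomial (Fin m × Fin n) B)) = 0 := by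
      rw [map_sub, ha, Subalgebra.smul_def, smul_eq_mul, map_mul, sub_self]
    rw [h0, C_0, sub_zero] at he
    refine ⟨F ^ e * h, fun hp => ((Ideal.IsPrime.mem_or_mem inferInstance hp).elim (hFp e) hhq), ?_⟩
    rw [← Submodule.map_smul'']
    refine ⟨_, he, ?_⟩
    rw [mul_smul, ← map_smul, ← map_smul, Submodule.mkQ_apply, Submodule.mkQ_apply,
      Submodule.Quotient.eq, smul_sub, sub_sub_cancel_left]
    exact neg_mem ⟨F ^ e * a, rfl⟩
  obtain ⟨s, hsp, hs⟩ := hNak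
  have hsN (x) (hx : x ∈ N) : (s : MvPolynomial (Fin m × Fin n) B) * x ∈ A := by
    have := hs _ ⟨x, hx, rfl⟩
    rw [← map_smul, Submodule.mkQ_apply, Submodule.Quotient.mk_eq_zero] at this
    obtain ⟨a, ha⟩ := this
    rw [← smul_eq_mul, ← Subalgebra.smul_def, ← ha]
    exact a.2
  have hval (c : Fin m × Fin n → k) : eval (fun i => algebraMap k (B ⧸ q) (c i))
      (map (Ideal.Quotient.mk q) (s : MvPolynomial (Fin m × Fin n) B)) =
      Ideal.Quotient.mk q (specialize c (s : MvPolynomial (Fin m × Fin n) B)) := by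
    rw [eval_map, specialize, AlgHom.restrictScalars_apply, aeval_def, hom_eval₂]
    rfl
  have h1 := ForGeneral.of_eval_ne_zero
    (map (Ideal.Quotient.mk q) (s : MvPolynomial (Fin m × Fin n) B)) c₀ (by
      rw [hval, Ne, Ideal.Quotient.eq_zero_iff_mem]
      exact hsp)
  have h2 : ForGeneral fun c => eval c f ≠ 0 :=
    forGeneral_iff.mpr ⟨f, fun h => hf0 (by rw [h, map_zero]), fun _ h => h⟩
  refine (h1.and h2).mono fun c ⟨hc1, hc2⟩ => ⟨_, hspec c s.2, ?_, fun b => ?_⟩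
  · rwa [hval, Ne, Ideal.Quotient.eq_zero_iff_mem] at hc1
  · obtain ⟨e, he⟩ := hfN (C b)
    have h3 := hspec c (hsN _ he)
    rw [map_mul, map_mul, map_pow, specialize_map, specialize_C, mul_left_comm, ← map_pow,
      ← Algebra.smul_def] at h3
    have h4 := Subalgebra.smul_mem _ h3 (eval c f ^ e)⁻¹
    rwa [smul_smul, inv_mul_cancel₀ (pow_ne_zero e hc2), one_smul] at h4

end

/-! ### The conductor and the dimension of the cokernel -/

section

variable {P A B : Type*} [CommRing P] [CommRing A] [CommRing B] [Algebra P A] [Algebra A B]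
  [Algebra P B] [IsScalarTower P A B]

open KaehlerDifferential

theorem D_algebraMap_mem_span_of_adjoin_eq_top {ι : Type*} {t : ι → A}
    (ht : Algebra.adjoin P (Set.range t) = ⊤) (a : A) : D P B (algebraMap A B a) ∈
      Submodule.span B (Set.range fun i => D P B (algebraMap A B (t i))) := by
  have ha : a ∈ Algebra.adjoin P (Set.range t) := by rw [ht]; trivial
  induction ha using Algebra.adjoin_induction with
  | mem a ha =>
    obtain ⟨i, rfl⟩ := ha
    exact Submodule.subset_span ⟨i, rfl⟩
  | algebraMap p =>
    rw [← IsScalarTower.algebraMap_apply, Derivation.map_algebraMap]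
    exact zero_mem _
  | add a b _ _ ha hb => rw [map_add, map_add]; exact add_mem ha hb
  | mul a b _ _ ha hb =>
    rw [map_mul, Derivation.leibniz]
    exact add_mem (Submodule.smul_mem _ _ hb) (Submodule.smul_mem _ _ ha)

/-- If `A` is generated by `s` elements over `P` and `A → B` is an isomorphism near `q`, then
`Ω[B⁄P]` is generated by `s` elements near `q`. -/
theorem embeddingDimension_le_of_conductor [Algebra.FiniteType P B] {s : ℕ} {t : Fin s → A}
    (ht : Algebra.adjoin P (Set.range t) = ⊤) (q : Ideal B) [q.IsPrime]
    [Algebra.FormallyEtale P q.ResidueField] {h : A} (hq : algebraMap A B h ∉ q)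
    (hh : ∀ b : B, ∃ a, algebraMap A B a = algebraMap A B h * b) :
    embeddingDimension (Localization.AtPrime q) ≤ s := by
  rw [embeddingDimension_eq_finrank (P := P)]
  have hx (x : Ω[B⁄P]) : algebraMap A B h • x ∈
      Submodule.span B (Set.range fun i => D P B (algebraMap A B (t i))) := by
    have hx : x ∈ Submodule.span B (Set.range (D P B)) := by
      rw [KaehlerDifferential.span_range_derivation]; trivial
    induction hx using Submodule.span_induction with
    | mem x hx =>
      obtain ⟨b, rfl⟩ := hx
      obtain ⟨a, ha⟩ := hh b
      have h1 := (D P B).leibniz (algebraMap A B h) b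
      rw [← sub_eq_iff_eq_add] at h1
      rw [← h1, ← ha]
      exact sub_mem (D_algebraMap_mem_span_of_adjoin_eq_top ht a)
        (Submodule.smul_mem _ _ (D_algebraMap_mem_span_of_adjoin_eq_top ht h))
    | zero => rw [smul_zero]; exact zero_mem _
    | add x y _ _ hx hy => rw [smul_add]; exact add_mem hx hy
    | smul b x _ hx => rw [smul_comm]; exact Submodule.smul_mem _ _ hx
  have hspan := (q.span_one_tmul_eq_top_iff _).mpr ⟨_, hq, hx⟩
  rw [← finrank_top, ← hspan]
  exact (finrank_range_le_card _).trans (Fintype.card_fin s).le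

variable [Module.Finite P B] {d : ℕ}

theorem isIntegral_of_injective_algebraMap (hinj : Function.Injective (algebraMap A B)) :
    Algebra.IsIntegral P A :=
  .of_injective (IsScalarTower.toAlgHom P A B) hinj

variable [IsDomain P]

/-- The cokernel of `A → B` has smaller dimension than `B` if and only if, for each component of `B`
of maximal dimension, the conductor of `A → B` does not vanish on it. -/
theorem supportDim_quotient_range_lt_iff (hP : ringKrullDim P = d)
    (hinj : Function.Injective (algebraMap A B)) :
    Module.supportDim A (B ⧸ LinearMap.range (Algebra.linearMap A B)) < d ↔
      ∀ (q : Ideal B) [q.IsPrime], ringKrullDim (B ⧸ q) = d → ∃ h : A, algebraMap A B h ∉ q ∧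
        ∀ b : B, ∃ a, algebraMap A B a = algebraMap A B h * b := by
  have : Algebra.IsIntegral P A := isIntegral_of_injective_algebraMap (B := B) hinj
  have : Module.Finite A B := .of_restrictScalars_finite P A B
  have hcomap (q : Ideal B) : (q.comap (algebraMap A B)).comap (algebraMap P A) =
      q.comap (algebraMap P B) := by
    rw [Ideal.comap_comap, ← IsScalarTower.algebraMap_eq]
  rw [Module.supportDim_lt_iff_forall_comap_ne_bot hP]
  constructor
  · intro h q _ hqd
    rw [← Ideal.comap_eq_bot_iff_ringKrullDim_quotient_eq hP, ← hcomap] at hqd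
    have h1 : (⟨q.comap (algebraMap A B), inferInstance⟩ : PrimeSpectrum A) ∉
        Module.support A (B ⧸ LinearMap.range (Algebra.linearMap A B)) := fun hp => h _ hp hqd
    rw [Module.mem_support_iff_of_finite, SetLike.not_le_iff_exists] at h1
    obtain ⟨a, ha, haq⟩ := h1
    refine ⟨a, haq, fun b => ?_⟩
    have h2 := Module.mem_annihilator.mp ha (Submodule.Quotient.mk b)
    rw [← Submodule.Quotient.mk_smul, Submodule.Quotient.mk_eq_zero] at h2
    obtain ⟨a', ha'⟩ := h2
    exact ⟨a', by rw [← Algebra.smul_def, ← ha']; rfl⟩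
  · intro h p hp h0
    have := (faithfulSMul_iff_algebraMap_injective A B).mpr hinj
    obtain ⟨q, hq⟩ := Algebra.IsIntegral.comap_surjective A B p
    have hqp : q.asIdeal.comap (algebraMap A B) = p.asIdeal := congrArg PrimeSpectrum.asIdeal hq
    rw [← hqp, hcomap, Ideal.comap_eq_bot_iff_ringKrullDim_quotient_eq hP] at h0
    obtain ⟨a, ha, hab⟩ := h q.asIdeal h0
    rw [Module.mem_support_iff'] at hp
    obtain ⟨m, hm⟩ := hp
    obtain ⟨b, rfl⟩ := Submodule.Quotient.mk_surjective _ m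
    refine hm a (by rwa [← hqp]) ?_
    obtain ⟨a', ha'⟩ := hab b
    rw [← Submodule.Quotient.mk_smul, Submodule.Quotient.mk_eq_zero]
    exact ⟨a', by rw [Algebra.smul_def, ← ha']; rfl⟩

/-- If the differentials of the `t i` generate `Ω[B⁄P]` at every component of maximal dimension and
`w` separates geometric points over the generic point of `P`, the cokernel of `A → B` is small. -/
theorem supportDim_quotient_range_lt_of_unramified (hP : ringKrullDim P = d)
    (hinj : Function.Injective (algebraMap A B)) {ι : Type*} (t : ι → A)
    (ht : ∀ (q : Ideal B) [q.IsPrime], ringKrullDim (B ⧸ q) = d → ∃ h ∉ q, ∀ x : Ω[B⁄P],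
      h • x ∈ Submodule.span B (Set.range fun i => D P B (algebraMap A B (t i))))
    {L : Type*} [Field L] [IsAlgClosed L] [Algebra P L] [FaithfulSMul P L] (w : A)
    (hw : ∀ σ τ : B →ₐ[P] L, σ (algebraMap A B w) = τ (algebraMap A B w) → σ = τ) :
    Module.supportDim A (B ⧸ LinearMap.range (Algebra.linearMap A B)) < d := by
  have : Algebra.IsIntegral P A := isIntegral_of_injective_algebraMap (B := B) hinj
  have : Module.Finite A B := .of_restrictScalars_finite P A B
  rw [Module.supportDim_lt_iff_forall_comap_ne_bot hP]
  intro p hp h0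
  have := subsingleton_algHom_algebraicClosure_residueField (B := B) p.asIdeal h0 w hw
  refine notMem_support_quotient_of_unramified (P := P) p t (fun q _ hq => ht q ?_) hp
  rw [← Ideal.comap_eq_bot_iff_ringKrullDim_quotient_eq hP, IsScalarTower.algebraMap_eq P A B,
    ← Ideal.comap_comap, hq, h0]

end

/-! ### Linear Noether normalizations unramified at the top components -/

section

variable {k B : Type*} [Field k] [CommRing B] [Algebra k B] {n d s : ℕ} {y : Fin n → B}

open KaehlerDifferential

theorem finite_setOf_ringKrullDim_quotient_eq {P : Type*} [CommRing P] [IsDomain P]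
    [IsNoetherianRing B] [Algebra P B] [Algebra.IsIntegral P B] (hP : ringKrullDim P = d) :
    {q : PrimeSpectrum B | ringKrullDim (B ⧸ q.asIdeal) = d}.Finite := by
  refine Set.Finite.of_finite_image (f := PrimeSpectrum.asIdeal) ?_
    (fun p _ q _ h => PrimeSpectrum.ext h)
  refine (minimalPrimes.finite_of_isNoetherianRing B).subset ?_
  rintro _ ⟨q, hq, rfl⟩
  exact Ideal.mem_minimalPrimes_of_comap_eq_bot (P := P) q.asIdeal
    ((Ideal.comap_eq_bot_iff_ringKrullDim_quotient_eq hP q.asIdeal).mpr hq)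

theorem map_linearCombinations {M : Type*} [AddCommGroup M] [Module k M] (f : B →ₗ[k] M)
    (y : Fin n → B) {m : ℕ} (c : Fin m × Fin n → k) (i : Fin m) :
    f (linearCombinations y c i) = ∑ j, c (i, j) • f (y j) := by
  simp [linearCombinations]

/-- If `B` has embedding dimension at most `s` at each component of maximal dimension, then the
differentials of `s` general linear combinations of the generators generate `Ω[B⁄P]` at these
components, and one of the combinations separates the points of `B` over `P`. As `s` is positive,
there is a combination to choose. -/
theorem forGeneral_unramified_and_separates [Infinite k] {P : Type*} [CommRing P] [IsDomain P]
    [Algebra k P] [Algebra P B] [IsScalarTower k P B] [Module.Finite P B] [IsNoetherianRing B]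
    (hP : ringKrullDim P = d) (hy : Algebra.adjoin k (Set.range y) = ⊤) (hs : 0 < s)
    (hunr : ∀ (q : Ideal B) [q.IsPrime], ringKrullDim (B ⧸ q) = d →
      Algebra.FormallyUnramified P q.ResidueField)
    (hq : ∀ (q : Ideal B) [q.IsPrime], q ∈ minimalPrimes B → ringKrullDim (B ⧸ q) = d →
      embeddingDimension (Localization.AtPrime q) ≤ s)
    (L : Type*) [Field L] [Algebra P L] [Algebra k L] [IsScalarTower k P L] :
    ForGeneral fun c : Fin s × Fin n → k =>
      (∀ (q : Ideal B) [q.IsPrime], ringKrullDim (B ⧸ q) = d → ∃ h ∉ q, ∀ x : Ω[B⁄P],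
        h • x ∈ Submodule.span B (Set.range fun i => D P B (linearCombinations y c i))) ∧
      ∃ i, ∀ σ τ : B →ₐ[P] L,
        σ (linearCombinations y c i) = τ (linearCombinations y c i) → σ = τ := by
  have h1 := ForGeneral.forall_mem_finite (k := k) (σ := Fin s × Fin n)
    (finite_setOf_ringKrullDim_quotient_eq (B := B) hP)
    (P := fun q c => Submodule.span q.asIdeal.ResidueField (Set.range fun i =>
      (1 : q.asIdeal.ResidueField) ⊗ₜ[B] D P B (linearCombinations y c i)) = ⊤) (by
      intro q hqd
      rw [Set.mem_ofPred_eq] at hqd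
      have h0 := (Ideal.comap_eq_bot_iff_ringKrullDim_quotient_eq hP q.asIdeal).mpr hqd
      have := hunr q.asIdeal hqd
      have := q.asIdeal.formallyEtale_residueField h0
      have hle := hq q.asIdeal (Ideal.mem_minimalPrimes_of_comap_eq_bot q.asIdeal h0) hqd
      rw [embeddingDimension_eq_finrank (P := P)] at hle
      have htop : Submodule.span q.asIdeal.ResidueField (Set.range fun j =>
          (1 : q.asIdeal.ResidueField) ⊗ₜ[B] D P B (y j)) = ⊤ := by
        refine (q.asIdeal.span_one_tmul_eq_top_iff _).mpr
          ⟨1, (Ideal.ne_top_iff_one _).mp q.2.ne_top, fun x => ?_⟩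
        have hyP : Algebra.adjoin P (Set.range y) = ⊤ := by
          have h : Algebra.adjoin k (Set.range y) ≤
              (Algebra.adjoin P (Set.range y)).restrictScalars k :=
            Algebra.adjoin_le Algebra.subset_adjoin
          rw [hy] at h
          exact eq_top_iff.mpr fun b _ => h (x := b) trivial
        rw [span_range_D_eq_top_of_adjoin_eq_top hyP]
        trivial
      refine (ForGeneral.span_linearCombination_eq_top _ htop hle).mono fun c hc => ?_
      have hmap (i) : (1 : q.asIdeal.ResidueField) ⊗ₜ[B] D P B (linearCombinations y c i) =
          ∑ j, c (i, j) • (1 : q.asIdeal.ResidueField) ⊗ₜ[B] D P B (y j) :=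
        map_linearCombinations (((TensorProduct.mk B q.asIdeal.ResidueField
          Ω[B⁄P] 1).restrictScalars k).comp ((D P B).toLinearMap.restrictScalars k)) y c i
      simpa only [hmap] using hc)
  refine (h1.and (forGeneral_separates (P := P) (L := L) hy ⟨0, hs⟩)).mono fun c hc =>
    ⟨fun q _ hqd => (q.span_one_tmul_eq_top_iff _).mp (hc.1 ⟨q, inferInstance⟩ hqd), _, hc.2⟩

/-- A reduction spanned by `1` and `d` elements `z` is a Noether normalization: `B` is finite over
the polynomial ring mapped to it by `z`. -/
theorem finite_mvPolynomial_of_isReduction {z : Fin d → B}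
    (hy : Algebra.adjoin k (Set.range y) = ⊤)
    (hz : IsReduction (unitalSpan k z) (unitalSpan k y)) :
    letI := (MvPolynomial.aeval (R := k) z).toRingHom.toAlgebra
    Module.Finite (MvPolynomial (Fin d) k) B := by
  let := (MvPolynomial.aeval (R := k) z).toRingHom.toAlgebra
  have hfin := hz.finite hy (A := (MvPolynomial.aeval (R := k) z).range)
    (unitalSpan_le_iff.mpr ⟨Submodule.one_le.mpr (one_mem (MvPolynomial.aeval (R := k) z).range),
      fun i => ⟨MvPolynomial.X i, MvPolynomial.aeval_X _ _⟩⟩)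
  have h1 : (MvPolynomial.aeval (R := k) z).rangeRestrict.toRingHom.Finite :=
    .of_surjective _ (MvPolynomial.aeval (R := k) z).rangeRestrict_surjective
  exact (RingHom.Finite.comp (RingHom.finite_algebraMap.mpr hfin) h1 :)

theorem formallyUnramified_mvPolynomial_residueField {z : Fin d → B} (q : Ideal B) [q.IsPrime]
    (hspan : Submodule.span q.ResidueField (Set.range fun i =>
      D k q.ResidueField (algebraMap B q.ResidueField (z i))) = ⊤) :
    letI := (MvPolynomial.aeval (R := k) z).toRingHom.toAlgebra
    Algebra.FormallyUnramified (MvPolynomial (Fin d) k) q.ResidueField := by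
  let := (MvPolynomial.aeval (R := k) z).toRingHom.toAlgebra
  have : IsScalarTower k (MvPolynomial (Fin d) k) B :=
    .of_algebraMap_eq' (MvPolynomial.aeval (R := k) z).comp_algebraMap.symm
  have hX (i) : algebraMap (MvPolynomial (Fin d) k) q.ResidueField (MvPolynomial.X i) =
      algebraMap B q.ResidueField (z i) := by
    rw [IsScalarTower.algebraMap_apply _ B q.ResidueField]
    exact congrArg _ (MvPolynomial.aeval_X _ _)
  have : IsScalarTower k (MvPolynomial (Fin d) k) q.ResidueField := .to₁₂₄ k _ B _
  rw [formallyUnramified_iff_span_eq_top (k := k) (MvPolynomial.adjoin_range_X)]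
  simpa only [hX] using hspan

/-- The residue fields of the components of maximal dimension have at most `d` independent
differentials. -/
theorem finrank_kaehlerDifferential_residueField_le [Infinite k] [PerfectField k]
    (hy : Algebra.adjoin k (Set.range y) = ⊤) (hd : ringKrullDim B = d) (q : Ideal B) [q.IsPrime]
    (hq : ringKrullDim (B ⧸ q) = d) : Module.finrank q.ResidueField Ω[q.ResidueField⁄k] ≤ d := by
  obtain ⟨z, -, hz⟩ := exists_isReduction_of_ringKrullDim_eq hy hd
  let := (MvPolynomial.aeval (R := k) z).toRingHom.toAlgebra
  have := finite_mvPolynomial_of_isReduction hy hz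
  have : IsScalarTower k (MvPolynomial (Fin d) k) B :=
    .of_algebraMap_eq' (MvPolynomial.aeval (R := k) z).comp_algebraMap.symm
  have : Algebra.FiniteType k B := ⟨(Subalgebra.fg_def).mpr ⟨_, Set.finite_range y, hy⟩⟩
  have : Algebra.EssFiniteType k q.ResidueField := .comp k B _
  exact finrank_kaehlerDifferential_le_of_trdeg_le k _ (q.trdeg_residueField_le
    ((Ideal.comap_eq_bot_iff_ringKrullDim_quotient_eq (MvPolynomial.ringKrullDim_fin k d) q).mpr hq)
    (MvPolynomial.adjoin_range_X))

theorem finite_setOf_ringKrullDim_quotient_eq_of_adjoin_eq_top [Infinite k]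
    (hy : Algebra.adjoin k (Set.range y) = ⊤) (hd : ringKrullDim B = d) :
    {q : PrimeSpectrum B | ringKrullDim (B ⧸ q.asIdeal) = d}.Finite := by
  obtain ⟨z, -, hz⟩ := exists_isReduction_of_ringKrullDim_eq hy hd
  let := (MvPolynomial.aeval (R := k) z).toRingHom.toAlgebra
  have := finite_mvPolynomial_of_isReduction hy hz
  have : IsNoetherianRing B := .of_finite (MvPolynomial (Fin d) k) B
  exact finite_setOf_ringKrullDim_quotient_eq (MvPolynomial.ringKrullDim_fin k d)

/-- A linear Noether normalization by `d` general linear combinations of the generators is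
generically unramified on each component of maximal dimension. -/
theorem forGeneral_isReduction_and_span_D_eq_top [Infinite k] [PerfectField k]
    (hy : Algebra.adjoin k (Set.range y) = ⊤) (hd : ringKrullDim B = d) :
    ForGeneral fun c : Fin d × Fin n → k =>
      IsReduction (unitalSpan k (linearCombinations y c)) (unitalSpan k y) ∧
      ∀ (q : Ideal B) [q.IsPrime], ringKrullDim (B ⧸ q) = d →
        Submodule.span q.ResidueField (Set.range fun i =>
          D k q.ResidueField (algebraMap B q.ResidueField (linearCombinations y c i))) = ⊤ := by
  have : Algebra.FiniteType k B := ⟨(Subalgebra.fg_def).mpr ⟨_, Set.finite_range y, hy⟩⟩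
  refine ((forGeneral_isReduction hy hd).and (ForGeneral.forall_mem_finite
    (finite_setOf_ringKrullDim_quotient_eq_of_adjoin_eq_top hy hd)
    (P := fun q c => Submodule.span q.asIdeal.ResidueField (Set.range fun i =>
      D k q.asIdeal.ResidueField (algebraMap B q.asIdeal.ResidueField
        (linearCombinations y c i))) = ⊤) ?_)).mono fun c hc =>
          ⟨hc.1, fun q _ hqd => hc.2 ⟨q, inferInstance⟩ hqd⟩
  intro q hqd
  have htop := (formallyUnramified_iff_span_eq_top (K := q.asIdeal.ResidueField) hy).mp
    inferInstance
  have : Algebra.EssFiniteType k q.asIdeal.ResidueField := .comp k B _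
  refine (ForGeneral.span_linearCombination_eq_top _ htop
    (finrank_kaehlerDifferential_residueField_le hy hd q.asIdeal hqd)).mono fun c hc => ?_
  have hmap (i) : D k q.asIdeal.ResidueField (algebraMap B q.asIdeal.ResidueField
      (linearCombinations y c i)) =
      ∑ j, c (i, j) • D k q.asIdeal.ResidueField (algebraMap B q.asIdeal.ResidueField (y j)) :=
    map_linearCombinations ((D k q.asIdeal.ResidueField).toLinearMap.comp
      (IsScalarTower.toAlgHom k B q.asIdeal.ResidueField).toLinearMap) y c i
  simpa only [hmap] using hc

/-- The characterization of `supportDim_quotient_range_lt_iff` for a subalgebra that contains a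
linear Noether normalization. -/
theorem supportDim_quotientModule_lt_iff (hy : Algebra.adjoin k (Set.range y) = ⊤) {z : Fin d → B}
    (hz : IsReduction (unitalSpan k z) (unitalSpan k y)) {A : Subalgebra k B} (hzA : ∀ i, z i ∈ A) :
    Module.supportDim A A.QuotientModule < d ↔
      ∀ (q : Ideal B) [q.IsPrime], ringKrullDim (B ⧸ q) = d →
        ∃ h ∈ A, h ∉ q ∧ ∀ b, h * b ∈ A := by
  let := (MvPolynomial.aeval (R := k) z).toRingHom.toAlgebra
  have := finite_mvPolynomial_of_isReduction hy hz
  let := (MvPolynomial.aeval (R := k) fun i => (⟨z i, hzA i⟩ : A)).toRingHom.toAlgebra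
  have : IsScalarTower (MvPolynomial (Fin d) k) A B := .of_algebraMap_eq' (by
    ext <;> simp [RingHom.algebraMap_toAlgebra])
  rw [supportDim_quotient_range_lt_iff (MvPolynomial.ringKrullDim_fin k d) Subtype.val_injective]
  refine forall₂_congr fun q _ => forall_congr' fun _ => ?_
  constructor
  · rintro ⟨h, hq, hh⟩
    refine ⟨h, h.2, hq, fun b => ?_⟩
    obtain ⟨a, ha⟩ := hh b
    exact ha ▸ a.2
  · rintro ⟨h, hA, hq, hh⟩
    exact ⟨⟨h, hA⟩, hq, fun b => ⟨⟨_, hh b⟩, rfl⟩⟩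

/-- If `A` is generated by `s` elements over a linear Noether normalization that is unramified at
`q`, and `A → B` is an isomorphism near `q`, then `B` has embedding dimension at most `s` at `q`. -/
theorem embeddingDimension_le_of_mem_conductor (hy : Algebra.adjoin k (Set.range y) = ⊤)
    {z : Fin d → B} (hz : IsReduction (unitalSpan k z) (unitalSpan k y)) {t : Fin s → B}
    {A : Subalgebra k B} (hA : A = Algebra.adjoin k (Set.range z ∪ Set.range t)) (q : Ideal B)
    [q.IsPrime] (hqd : ringKrullDim (B ⧸ q) = d)
    (hspan : Submodule.span q.ResidueField (Set.range fun i =>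
      D k q.ResidueField (algebraMap B q.ResidueField (z i))) = ⊤)
    {h : B} (hhA : h ∈ A) (hq : h ∉ q) (hh : ∀ b, h * b ∈ A) :
    embeddingDimension (Localization.AtPrime q) ≤ s := by
  let := (MvPolynomial.aeval (R := k) z).toRingHom.toAlgebra
  have := finite_mvPolynomial_of_isReduction hy hz
  have hzA (i) : z i ∈ A := hA ▸ Algebra.subset_adjoin (Or.inl ⟨i, rfl⟩)
  have htA (i) : t i ∈ A := hA ▸ Algebra.subset_adjoin (Or.inr ⟨i, rfl⟩)
  let := (MvPolynomial.aeval (R := k) fun i => (⟨z i, hzA i⟩ : A)).toRingHom.toAlgebra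
  have : IsScalarTower (MvPolynomial (Fin d) k) A B := .of_algebraMap_eq' (by
    ext <;> simp [RingHom.algebraMap_toAlgebra])
  have : IsScalarTower k (MvPolynomial (Fin d) k) B :=
    .of_algebraMap_eq' (MvPolynomial.aeval (R := k) z).comp_algebraMap.symm
  have : IsScalarTower k (MvPolynomial (Fin d) k) A :=
    .of_algebraMap_eq' (MvPolynomial.aeval (R := k) _).comp_algebraMap.symm
  have : Algebra.FormallyUnramified (MvPolynomial (Fin d) k) q.ResidueField :=
    formallyUnramified_mvPolynomial_residueField q hspan
  have := q.formallyEtale_residueField (P := MvPolynomial (Fin d) k)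
    ((Ideal.comap_eq_bot_iff_ringKrullDim_quotient_eq (MvPolynomial.ringKrullDim_fin k d) q).mpr
      hqd)
  refine embeddingDimension_le_of_conductor (P := MvPolynomial (Fin d) k) (A := A)
    (t := fun i => ⟨t i, htA i⟩) ?_ q (h := ⟨h, hhA⟩) hq fun b => ⟨⟨_, hh b⟩, rfl⟩
  rw [eq_top_iff]
  rintro ⟨a, ha⟩ -
  have key : A ≤ ((Algebra.adjoin (MvPolynomial (Fin d) k)
      (Set.range fun i => (⟨t i, htA i⟩ : A))).restrictScalars k).map A.val := by
    conv_lhs => rw [hA]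
    refine Algebra.adjoin_le (Set.union_subset ?_ ?_)
    · rintro _ ⟨i, rfl⟩
      refine ⟨⟨z i, hzA i⟩, ?_, rfl⟩
      have := (Algebra.adjoin (MvPolynomial (Fin d) k)
        (Set.range fun i => (⟨t i, htA i⟩ : A))).algebraMap_mem (MvPolynomial.X i)
      rwa [RingHom.algebraMap_toAlgebra, AlgHom.toRingHom_eq_coe, RingHom.coe_coe,
        MvPolynomial.aeval_X] at this
    · rintro _ ⟨i, rfl⟩
      exact ⟨⟨t i, htA i⟩, Algebra.subset_adjoin ⟨i, rfl⟩, rfl⟩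
  obtain ⟨a', ha', h'⟩ := key ha
  obtain rfl : a' = ⟨a, ha⟩ := Subtype.ext h'
  exact ha'

/-- Given a linear Noether normalization that is generically unramified on the components of maximal
dimension, `s` suitable further linear combinations of the generators make the cokernel small if
the embedding dimensions are at most `s`. -/
theorem exists_supportDim_quotientModule_lt [Infinite k] [IsNoetherianRing B]
    (hy : Algebra.adjoin k (Set.range y) = ⊤) (hs : 0 < s)
    {z : Fin d → B} (hz : IsReduction (unitalSpan k z) (unitalSpan k y))
    (hspan : ∀ (q : Ideal B) [q.IsPrime], ringKrullDim (B ⧸ q) = d →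
      Submodule.span q.ResidueField (Set.range fun i =>
        D k q.ResidueField (algebraMap B q.ResidueField (z i))) = ⊤)
    (hq : ∀ (q : Ideal B) [q.IsPrime], q ∈ minimalPrimes B → ringKrullDim (B ⧸ q) = d →
      embeddingDimension (Localization.AtPrime q) ≤ s) :
    ∃ c : Fin s × Fin n → k, ∀ A : Subalgebra k B, (∀ i, z i ∈ A) →
      (∀ i, linearCombinations y c i ∈ A) → Module.supportDim A A.QuotientModule < d := by
  let := (MvPolynomial.aeval (R := k) z).toRingHom.toAlgebra
  have := finite_mvPolynomial_of_isReduction hy hz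
  have : IsScalarTower k (MvPolynomial (Fin d) k) B :=
    .of_algebraMap_eq' (MvPolynomial.aeval (R := k) z).comp_algebraMap.symm
  have hunr (q : Ideal B) [q.IsPrime] (hqd : ringKrullDim (B ⧸ q) = d) :
      Algebra.FormallyUnramified (MvPolynomial (Fin d) k) q.ResidueField :=
    formallyUnramified_mvPolynomial_residueField q (hspan q hqd)
  obtain ⟨c, hc, i, hi⟩ := (forGeneral_unramified_and_separates (MvPolynomial.ringKrullDim_fin k d)
    hy hs hunr hq (AlgebraicClosure (FractionRing (MvPolynomial (Fin d) k)))).exists_point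
  refine ⟨c, fun A hzA htA => ?_⟩
  let := (MvPolynomial.aeval (R := k) fun i => (⟨z i, hzA i⟩ : A)).toRingHom.toAlgebra
  have : IsScalarTower (MvPolynomial (Fin d) k) A B := .of_algebraMap_eq' (by
    ext <;> simp [RingHom.algebraMap_toAlgebra])
  have : FaithfulSMul (MvPolynomial (Fin d) k)
      (AlgebraicClosure (FractionRing (MvPolynomial (Fin d) k))) := by
    rw [faithfulSMul_iff_algebraMap_injective, IsScalarTower.algebraMap_eq _
      (FractionRing (MvPolynomial (Fin d) k))]
    exact (algebraMap (FractionRing (MvPolynomial (Fin d) k)) _).injective.comp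
      (IsFractionRing.injective _ _)
  exact supportDim_quotient_range_lt_of_unramified (MvPolynomial.ringKrullDim_fin k d)
    Subtype.val_injective (fun i => ⟨linearCombinations y c i, htA i⟩) hc ⟨_, htA i⟩ hi

end

/-! ### Finite generic projections -/

theorem linearCombinationSubalgebra_eq_adjoin_union {k B : Type*} [Field k] [CommRing B]
    [Algebra k B] {n d s : ℕ} (y : Fin n → B) (c : Fin (d + s) × Fin n → k) :
    linearCombinationSubalgebra y c = Algebra.adjoin k
      (Set.range (fun i : Fin d => linearCombinations y c (Fin.castAdd s i)) ∪
        Set.range fun i : Fin s => linearCombinations y c (Fin.natAdd d i)) := by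
  refine congrArg (Algebra.adjoin k) (Set.Subset.antisymm ?_ (Set.union_subset ?_ ?_))
  · rintro _ ⟨i, rfl⟩
    exact Fin.addCases (fun i => Or.inl ⟨i, rfl⟩) (fun i => Or.inr ⟨i, rfl⟩) i
  · rintro _ ⟨i, rfl⟩
    exact ⟨_, rfl⟩
  · rintro _ ⟨i, rfl⟩
    exact ⟨_, rfl⟩

theorem theorem2p3 {k B : Type*} [Field k] [Infinite k] [PerfectField k]
    [CommRing B] [Algebra k B] (n d s : ℕ) (y : Fin n → B)
    (hy : Algebra.adjoin k (Set.range y) = ⊤) (hd : ringKrullDim B = d) (hs : 0 < s) :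
    ForGeneral (fun c : Fin (d + s) × Fin n → k =>
      Module.Finite (linearCombinationSubalgebra y c) B ∧
      (Module.supportDim (linearCombinationSubalgebra y c)
          (linearCombinationSubalgebra y c).QuotientModule < d ↔
        ∀ (q : Ideal B) [q.IsPrime], q ∈ minimalPrimes B → ringKrullDim (B ⧸ q) = d →
          embeddingDimension (Localization.AtPrime q) ≤ s)) := by
  have hnorm := forGeneral_isReduction_and_span_D_eq_top hy hd
  have hV := hnorm.comp_injective (e := Prod.map (Fin.castAdd s) (id : Fin n → Fin n))
    ((Fin.castAdd_injective d s).prodMap Function.injective_id)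
  have hmem (c : Fin (d + s) × Fin n → k) (i : Fin d) :
      linearCombinations y (fun p => c (Prod.map (Fin.castAdd s) id p)) i ∈
        linearCombinationSubalgebra y c :=
    linearCombinations_mem_adjoin y c (Fin.castAdd s i)
  have hfin {c : Fin (d + s) × Fin n → k} (hc : IsReduction (unitalSpan k
      (linearCombinations y fun p => c (Prod.map (Fin.castAdd s) id p))) (unitalSpan k y)) :
      Module.Finite (linearCombinationSubalgebra y c) B :=
    hc.finite hy (unitalSpan_le_iff.mpr ⟨Submodule.one_le.mpr (one_mem
      (linearCombinationSubalgebra y c)), hmem c⟩)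
  by_cases hE : ∀ (q : Ideal B) [q.IsPrime], q ∈ minimalPrimes B → ringKrullDim (B ⧸ q) = d →
      embeddingDimension (Localization.AtPrime q) ≤ s
  -- with the bound on the embedding dimensions, a single point `c₀` satisfies the conductor
  -- condition, which then holds at general points; without it only the forward implication has
  -- content
  · have : Algebra.FiniteType k B := ⟨(Subalgebra.fg_def).mpr ⟨_, Set.finite_range y, hy⟩⟩
    have : IsNoetherianRing B := Algebra.FiniteType.isNoetherianRing k B
    obtain ⟨c₁, hred, hspan⟩ := hnorm.exists_point
    obtain ⟨c₂, hc₂⟩ := exists_supportDim_quotientModule_lt hy hs hred hspan hE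
    let c₀ : Fin (d + s) × Fin n → k := fun p =>
      Fin.addCases (fun i => c₁ (i, p.2)) (fun i => c₂ (i, p.2)) p.1
    have h₁ (i : Fin d) : linearCombinations y c₁ i =
        linearCombinations y c₀ (Fin.castAdd s i) := by simp [linearCombinations, c₀]
    have h₂ (i : Fin s) : linearCombinations y c₂ i =
        linearCombinations y c₀ (Fin.natAdd d i) := by simp [linearCombinations, c₀]
    have h₁A (i) : linearCombinations y c₁ i ∈ linearCombinationSubalgebra y c₀ :=
      h₁ i ▸ linearCombinations_mem_adjoin y c₀ _
    have hdim := hc₂ (linearCombinationSubalgebra y c₀) h₁A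
      fun i => h₂ i ▸ linearCombinations_mem_adjoin y c₀ _
    rw [supportDim_quotientModule_lt_iff hy hred h₁A] at hdim
    obtain ⟨D, hD⟩ := hred.2
    have hD₀ : unitalSpan k y ^ (D + 1) ≤
        unitalSpan k (linearCombinations y c₀) * unitalSpan k y ^ D :=
      hD.trans (mul_le_mul_left (unitalSpan_le_unitalSpan fun i =>
        h₁ i ▸ Submodule.subset_span ⟨_, rfl⟩) _)
    have hcond := ForGeneral.forall_mem_finite
      (finite_setOf_ringKrullDim_quotient_eq_of_adjoin_eq_top hy hd)
      fun q hq => forGeneral_exists_conductor_notMem hy hD₀ q.asIdeal fun b => by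
        obtain ⟨h, hA, hhq, hh⟩ := hdim q.asIdeal hq
        exact ⟨h, hA, hhq, hh b⟩
    refine (hV.and hcond).mono fun c hc => ⟨hfin hc.1.1, iff_of_true ?_ hE⟩
    rw [supportDim_quotientModule_lt_iff hy hc.1.1 (hmem c)]
    exact fun q _ hq => hc.2 ⟨q, inferInstance⟩ hq
  · refine hV.mono fun c hc => ⟨hfin hc.1, fun h q _ _ hqd => ?_, fun h => absurd h hE⟩
    rw [supportDim_quotientModule_lt_iff hy hc.1 (hmem c)] at h
    obtain ⟨a, haA, haq, ha⟩ := h q hqd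
    exact embeddingDimension_le_of_mem_conductor hy hc.1
      (linearCombinationSubalgebra_eq_adjoin_union y c) q hqd (hc.2 q hqd) haA haq ha
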